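/- Let $n\ge 10$ be even, and let $(e_{ij})_{1\le i,j\le n}$ be real numbers with $e_{ij}=e_{ji}$ and $e_{ii}=0$ for all $i,j$. Let $\pi$ be uniformly distributed over the set $$\Pi_n=\{\pi\in S_n:\ \pi^2=\mathrm{id},\ \pi(i)\ne i\text{ for all }i\}$$ of fixed-point-free involutions (perfect matchings), and let $U=\sum_{i=1}^n e_{i\pi(i)}$. Write $e_{i+}=\sum_{j}e_{ij}$, $e_{+j}=\sum_i e_{ij}$, $e_{++}=\sum_{i,j}e_{ij}$, and put $d_{ii}=0$ and $$d_{ij}=e_{ij}-\frac{e_{i+}}{n-2}-\frac{e_{+j}}{n-2}+\frac{e_{++}}{(n-1)(n-2)}\qquad(i\ne j),\qquad \alpha=\max_{i,j,k,l}|d_{ij}-d_{kl}|.$$ Then $$EU=\frac{e_{++}}{n-1},\qquad \mathrm{Var}(U)=\frac{2}{(n-1)(n-3)}\left((n-2)\sum_{i,k=1}^n e_{ik}^2+\frac{1}{n-1}e_{++}^2-2\sum_{i=1}^n e_{i+}^2\right).$$ Moreover, there are absolute constants $c_1\le 86$ and $c_2\le 243$ such that, whenever $\mathrm{Var}(U)>0$,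 with $W=(U-EU)/\sqrt{\mathrm{Var}(U)}$ and $\Phi$ the standard normal distribution function, $$\sup_{w\in\mathbb R}|P(W\le w)-\Phi(w)|\ \le\ c_1 n^{1/2}\left(\frac{\sum_{i,j=1}^n d_{ij}^4}{\big(\sum_{i,j=1}^n d_{ij}^2\big)^2}\right)^{1/2}+\frac{c_2\,\alpha^3 n^{5/2}}{\big(\sum_{i,j=1}^n d_{ij}^2\big)^{3/2}}.$$ -/

import Mathlib

open MeasureTheory ProbabilityTheory

noncomputable section

namespace MatchingTest

/-- All subsets of the finite group of permutations of `{1, …, n}` are measurable. -/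
instance permMeasurableSpace (n : ℕ) : MeasurableSpace (Equiv.Perm (Fin n)) := ⊤

instance permDiscreteMeasurableSpace (n : ℕ) :
    DiscreteMeasurableSpace (Equiv.Perm (Fin n)) := ⟨fun _ => trivial⟩

/-- The set `Π_n` of fixed-point-free involutions (perfect matchings) of `n` points. -/
def matchings (n : ℕ) : Set (Equiv.Perm (Fin n)) :=
  {σ | σ ^ 2 = 1 ∧ ∀ i, σ i ≠ i}

/-- The row sum `g_{i+}`. -/
def rowSum {n : ℕ} (g : Fin n → Fin n → ℝ) (i : Fin n) : ℝ := ∑ j, g i j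

/-- The column sum `g_{+j}`. -/
def colSum {n : ℕ} (g : Fin n → Fin n → ℝ) (j : Fin n) : ℝ := ∑ i, g i j

/-- The total sum `g_{++}`. -/
def totalSum {n : ℕ} (g : Fin n → Fin n → ℝ) : ℝ := ∑ i, ∑ j, g i j

/-- The doubly centered array `d` of `e`, with zero diagonal. -/
def centered {n : ℕ} (e : Fin n → Fin n → ℝ) (i j : Fin n) : ℝ :=
  if i = j then 0
  else e i j - rowSum e i / ((n : ℝ) - 2) - colSum e j / ((n : ℝ) - 2)
    + totalSum e / (((n : ℝ) - 1) * ((n : ℝ) - 2))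

/-- The largest difference `max |d_{ij} - d_{kl}|` over all index pairs (a finite maximum). -/
def maxDiff {n : ℕ} (d : Fin n → Fin n → ℝ) : ℝ :=
  ⨆ p : (Fin n × Fin n) × (Fin n × Fin n), |d p.1.1 p.1.2 - d p.2.1 p.2.2|

/-- The statistic `U_σ = ∑ i, e_{i σ(i)}`. -/
def matchingStat {n : ℕ} (e : Fin n → Fin n → ℝ) (σ : Equiv.Perm (Fin n)) : ℝ :=
  ∑ i, e i (σ i)

/-- The standardization `(X - E X) / √(Var X)`. -/
def standardize {Ω : Type*} [MeasurableSpace Ω] (X : Ω → ℝ) (P : Measure Ω) (ω : Ω) : ℝ :=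
  (X ω - ∫ ω', X ω' ∂P) / √(variance X P)

/-- The Kolmogorov distance `sup_w |P(X ≤ w) - Φ(w)|` to the standard normal law. -/
def kolmogorovDistNormal {Ω : Type*} [MeasurableSpace Ω] (X : Ω → ℝ) (P : Measure Ω) : ℝ :=
  ⨆ w : ℝ, |P.real {ω | X ω ≤ w} - (gaussianReal 0 1).real (Set.Iic w)|

end MatchingTest

end

noncomputable section

namespace MatchingTest

/-! ### The Stein equation for the standard normal law -/

/-! The proof is Stein's method with a coupling that re-pairs points. Centering reduces everything
to a symmetric array `d` with zero diagonal and zero row sums: on matchings `matchingStat d` is `U -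
EU` (`matchingStat_centered`), and `sum_sq_centered` rewrites the variance in terms of `S = ∑
d_{ij}²`.

Conjugation by a transposition `(a k)` preserves the uniform law on matchings and sends the partner
of `a` to `σ k`, unless `k = σ a`, when it changes nothing. Averaging a sum over `a` of functions of
`σ` over all `k` (`card_mul_matchMean_sum`) is therefore the single source of moment identities.
Write `V = matchingStat d`, and `V'` for its value after conjugation. Since the rows sum to zero,
this gives the exact Stein coupling `(n-1) E[V f(V)] = E ∑_{a,k} d_{aσ(k)} (f(V') - f(V))`
(`stein_identity`).

With `f(x) = x` the right side is `2(S + E B)`, where `B = ∑ d_{ij} d_{σ(i)σ(j)}` (`crossStat`). The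
same averaging applied to `B` gives `(n-3) E B = S`, hence the variance. Applied to `B²` it gives `E
B² ≤ 24 n ∑ d_{ij}⁴` (`matchMean_crossStat_sq_le`), which controls the fluctuation of the
conditional second-order term.

For a bounded coupling, `stein_coupling_kolmogorov_bound` yields `4D + 20β + A`. Here `A` bounds the
jumps, `β` bounds the cubic term, and `D` is the mean deviation from one of the sum of weights times
jumps. Its proof solves the Stein equation for a smoothed indicator and bounds the probability of
the smoothing window by the Kolmogorov distance itself, with a width small enough to absorb that
distance. Substitution gives the two error terms, with numerical room in both constants. -/

lemma integrable_exp_neg_half_sq : Integrable (fun x : ℝ => Real.exp (-x ^ 2 / 2)) := by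
  have h := integrable_exp_neg_mul_sq (b := 1 / 2) (by norm_num)
  refine h.congr (Filter.Eventually.of_forall fun x => ?_)
  show Real.exp _ = Real.exp _
  congr 1; ring

lemma gaussianPDFReal_zero_one (x : ℝ) :
    gaussianPDFReal 0 1 x = (√(2 * Real.pi))⁻¹ * Real.exp (-x ^ 2 / 2) := by
  simp [gaussianPDFReal]

lemma gaussianPDFReal_zero_one_le_one (x : ℝ) : gaussianPDFReal 0 1 x ≤ 1 := by
  rw [gaussianPDFReal_zero_one]
  have h1 : (√(2 * Real.pi))⁻¹ ≤ 1 := by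
    apply inv_le_one_of_one_le₀
    rw [Real.one_le_sqrt]
    linarith [Real.pi_gt_three]
  have h2 : Real.exp (-x ^ 2 / 2) ≤ 1 := Real.exp_le_one_iff.2 (by nlinarith [sq_nonneg x])
  calc _ ≤ 1 * 1 := mul_le_mul h1 h2 (Real.exp_nonneg _) zero_le_one
    _ = 1 := one_mul 1

lemma integral_exp_neg_half_sq_eq_zero {g : ℝ → ℝ} (hg : ∫ x, g x ∂(gaussianReal 0 1) = 0) :
    ∫ x, g x * Real.exp (-x ^ 2 / 2) = 0 := by
  rw [integral_gaussianReal_eq_integral_smul one_ne_zero] at hg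
  have h : ∫ x, gaussianPDFReal 0 1 x • g x
      = (√(2 * Real.pi))⁻¹ * ∫ x, g x * Real.exp (-x ^ 2 / 2) := by
    rw [← integral_const_mul]
    refine integral_congr_ae (Filter.Eventually.of_forall fun x => ?_)
    simp only [gaussianPDFReal_zero_one, smul_eq_mul]
    ring
  rw [h] at hg
  rcases mul_eq_zero.1 hg with h0 | h0
  · have : 0 < (√(2 * Real.pi))⁻¹ := by positivity
    linarith
  · exact h0

lemma integrable_mul_exp_neg_half_sq :
    Integrable (fun x : ℝ => x * Real.exp (-x ^ 2 / 2)) := by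
  have h := integrable_mul_exp_neg_mul_sq (b := 1 / 2) (by norm_num)
  refine h.congr (Filter.Eventually.of_forall fun x => ?_)
  show _ * Real.exp _ = _ * Real.exp _
  congr 2; ring

/-- Mills' ratio: on `(w, ∞)` the factor `w` is at most `x`, and `x * exp (-x²/2)` has an explicit
primitive. -/
lemma mul_setIntegral_Ioi_exp_le (w : ℝ) :
    w * ∫ x in Set.Ioi w, Real.exp (-x ^ 2 / 2) ≤ Real.exp (-w ^ 2 / 2) := by
  have hd : ∀ x : ℝ, HasDerivAt (fun x : ℝ => -Real.exp (-x ^ 2 / 2))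
      (x * Real.exp (-x ^ 2 / 2)) x := by
    intro x
    have h1 : HasDerivAt (fun x : ℝ => -x ^ 2 / 2) (-x) x := by
      refine (((hasDerivAt_pow 2 x).neg).div_const 2).congr_deriv ?_
      norm_num
      ring
    exact h1.exp.neg.congr_deriv (by ring)
  have ht : Filter.Tendsto (fun x : ℝ => -Real.exp (-x ^ 2 / 2)) Filter.atTop (nhds 0) := by
    rw [← neg_zero]
    apply Filter.Tendsto.neg
    apply Real.tendsto_exp_atBot.comp
    have : Filter.Tendsto (fun x : ℝ => x ^ 2 / 2) Filter.atTop Filter.atTop :=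
      (Filter.tendsto_pow_atTop two_ne_zero).atTop_div_const two_pos
    refine (Filter.tendsto_neg_atTop_atBot.comp this).congr fun x => ?_
    show -(x ^ 2 / 2) = -x ^ 2 / 2
    ring
  have hi := integral_Ioi_of_hasDerivAt_of_tendsto (a := w) (hd w).continuousAt.continuousWithinAt
    (fun x _ => hd x) integrable_mul_exp_neg_half_sq.integrableOn ht
  rw [← integral_const_mul]
  calc _ ≤ ∫ x in Set.Ioi w, x * Real.exp (-x ^ 2 / 2) := by
        apply setIntegral_mono_on (integrable_exp_neg_half_sq.integrableOn.const_mul w)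
          integrable_mul_exp_neg_half_sq.integrableOn measurableSet_Ioi
        intro x hx
        exact mul_le_mul_of_nonneg_right (le_of_lt hx) (Real.exp_nonneg _)
    _ = _ := by rw [hi]; ring

/-- Mills' ratio suffices for `w ≥ 1`. Below `1`, the half-line Gaussian integral is at most `3/2`
and the exponential is at least `1/2`. -/
lemma setIntegral_Ioi_exp_le {w : ℝ} (hw : 0 ≤ w) :
    ∫ x in Set.Ioi w, Real.exp (-x ^ 2 / 2) ≤ 3 * Real.exp (-w ^ 2 / 2) := by
  rcases le_total 1 w with h | h
  · have h1 := mul_setIntegral_Ioi_exp_le w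
    have h0 : 0 ≤ ∫ x in Set.Ioi w, Real.exp (-x ^ 2 / 2) :=
      integral_nonneg fun x => Real.exp_nonneg _
    nlinarith [Real.exp_nonneg (-w ^ 2 / 2)]
  · have h1 : ∫ x in Set.Ioi w, Real.exp (-x ^ 2 / 2)
        ≤ ∫ x in Set.Ioi 0, Real.exp (-x ^ 2 / 2) :=
      setIntegral_mono_set integrable_exp_neg_half_sq.integrableOn
        (Filter.Eventually.of_forall fun x => Real.exp_nonneg _)
        (Set.Ioi_subset_Ioi hw).eventuallyLE
    have h2 : ∫ x in Set.Ioi (0 : ℝ), Real.exp (-x ^ 2 / 2) = √(Real.pi / (1 / 2)) / 2 := by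
      rw [← integral_gaussian_Ioi]
      congr 1; ext x; congr 1; ring
    have h3 : √(Real.pi / (1 / 2)) ≤ 3 := by
      rw [Real.sqrt_le_left (by norm_num)]
      linarith [Real.pi_lt_d2]
    have h4 : (1 : ℝ) / 2 ≤ Real.exp (-w ^ 2 / 2) := by
      have := Real.add_one_le_exp (-w ^ 2 / 2)
      nlinarith
    linarith

/-- The Stein equation of a continuous `[0,1]`-valued test function has a bounded solution. -/
lemma exists_stein_solution {h : ℝ → ℝ} (hc : Continuous h) (h01 : ∀ x, h x ∈ Set.Icc (0 : ℝ) 1) :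
    ∃ f : ℝ → ℝ,
      (∀ w, HasDerivAt f (w * f w + (h w - ∫ x, h x ∂(gaussianReal 0 1))) w) ∧
      (∀ w, |f w| ≤ 3) ∧ ∀ w, |w * f w| ≤ 1 := by
  set N := ∫ x, h x ∂(gaussianReal 0 1) with hN
  have hint : Integrable h (gaussianReal 0 1) :=
    Integrable.of_bound hc.aestronglyMeasurable 1
      (Filter.Eventually.of_forall fun x => by
        rw [Real.norm_eq_abs, abs_le]; constructor <;> linarith [(h01 x).1, (h01 x).2])
  have hN0 : 0 ≤ N := integral_nonneg fun x => (h01 x).1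
  have hN1 : N ≤ 1 := by
    have := integral_mono hint (integrable_const (1 : ℝ)) fun x => (h01 x).2
    simpa using this
  set g : ℝ → ℝ := fun x => (h x - N) * Real.exp (-x ^ 2 / 2) with hg
  have hgc : Continuous g := by fun_prop
  have hgb : ∀ x, ‖g x‖ ≤ Real.exp (-x ^ 2 / 2) := by
    intro x
    rw [hg, norm_mul, Real.norm_eq_abs, Real.norm_eq_abs, Real.abs_exp]
    have : |h x - N| ≤ 1 := by
      rw [abs_le]; constructor <;> linarith [(h01 x).1, (h01 x).2]
    nlinarith [Real.exp_nonneg (-x ^ 2 / 2)]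
  have hgi : Integrable g :=
    integrable_exp_neg_half_sq.mono' hgc.aestronglyMeasurable (Filter.Eventually.of_forall hgb)
  have hg0 : ∫ x, g x = 0 := by
    apply integral_exp_neg_half_sq_eq_zero
    rw [integral_sub hint (integrable_const _)]
    simp [hN]
  set F : ℝ → ℝ := fun w => ∫ x in Set.Iic w, g x with hF
  have hFd : ∀ w, HasDerivAt F (g w) w := by
    intro w
    have h1 : F = fun w => (∫ x in Set.Iic 0, g x) + ∫ x in (0 : ℝ)..w, g x := by
      ext w
      rw [← intervalIntegral.integral_Iic_sub_Iic hgi.integrableOn hgi.integrableOn]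
      simp [hF]
    rw [h1]
    exact (hgc.integral_hasStrictDerivAt 0 w).hasDerivAt.const_add _
  -- As `g` has integral zero, `F w` can be computed from either tail. Choosing the tail away from
  -- the origin gives the decay that offsets the factor `exp (w²/2)`.
  have hFb : ∀ w, |F w| ≤ ∫ x in Set.Ioi |w|, Real.exp (-x ^ 2 / 2) := by
    intro w
    rcases le_total 0 w with hw | hw
    · have h1 : F w = -∫ x in Set.Ioi w, g x := by
        have := integral_add_compl (measurableSet_Iic (a := w)) hgi
        rw [Set.compl_Iic, hg0] at this
        show ∫ x in Set.Iic w, g x = _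
        linarith
      rw [h1, abs_neg, abs_of_nonneg hw, ← Real.norm_eq_abs]
      exact norm_integral_le_of_norm_le integrable_exp_neg_half_sq.integrableOn
        (Filter.Eventually.of_forall hgb)
    · rw [abs_of_nonpos hw, ← integral_comp_neg_Iic, ← Real.norm_eq_abs]
      simp only [neg_sq]
      exact norm_integral_le_of_norm_le integrable_exp_neg_half_sq.integrableOn
        (Filter.Eventually.of_forall hgb)
  have hexp : ∀ w : ℝ, Real.exp (w ^ 2 / 2) * Real.exp (-w ^ 2 / 2) = 1 := by
    intro w; rw [← Real.exp_add]; simp; ring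
  refine ⟨fun w => Real.exp (w ^ 2 / 2) * F w, fun w => ?_, fun w => ?_, fun w => ?_⟩
  · have h1 : HasDerivAt (fun x : ℝ => Real.exp (x ^ 2 / 2)) (Real.exp (w ^ 2 / 2) * w) w := by
      have h2 : HasDerivAt (fun x : ℝ => x ^ 2 / 2) w w := by
        refine ((hasDerivAt_pow 2 w).div_const 2).congr_deriv ?_
        norm_num
      exact h2.exp
    refine (h1.mul (hFd w)).congr_deriv (Eq.symm ?_)
    show w * (Real.exp (w ^ 2 / 2) * F w) + (h w - N) = Real.exp (w ^ 2 / 2) * w * F w +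
      Real.exp (w ^ 2 / 2) * ((h w - N) * Real.exp (-w ^ 2 / 2))
    linear_combination (-(h w - N)) * hexp w
  · rw [abs_mul, Real.abs_exp]
    calc _ ≤ Real.exp (w ^ 2 / 2) * (3 * Real.exp (-w ^ 2 / 2)) := by
          apply mul_le_mul_of_nonneg_left _ (Real.exp_nonneg _)
          refine (hFb w).trans ?_
          have := setIntegral_Ioi_exp_le (abs_nonneg w)
          rwa [sq_abs] at this
      _ = 3 := by linear_combination 3 * hexp w
  · rw [abs_mul, abs_mul, Real.abs_exp]
    calc _ = Real.exp (w ^ 2 / 2) * (|w| * |F w|) := by ring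
      _ ≤ Real.exp (w ^ 2 / 2) * Real.exp (-w ^ 2 / 2) := by
          apply mul_le_mul_of_nonneg_left _ (Real.exp_nonneg _)
          refine (mul_le_mul_of_nonneg_left (hFb w) (abs_nonneg w)).trans ?_
          have := mul_setIntegral_Ioi_exp_le |w|
          rwa [sq_abs] at this
      _ = 1 := hexp w

/-- The continuous function equal to `1` left of `z`, to `0` right of `z + ε`, and affine between. -/
def smoothIndicator (z ε x : ℝ) : ℝ := max 0 (min 1 (1 - (x - z) / ε))

lemma continuous_smoothIndicator (z ε : ℝ) : Continuous (smoothIndicator z ε) := by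
  unfold smoothIndicator; fun_prop

lemma smoothIndicator_mem_Icc (z ε x : ℝ) : smoothIndicator z ε x ∈ Set.Icc (0 : ℝ) 1 :=
  ⟨le_max_left _ _, max_le zero_le_one (min_le_left _ _)⟩

lemma smoothIndicator_eq_one {z ε x : ℝ} (hε : 0 < ε) (hx : x ≤ z) : smoothIndicator z ε x = 1 := by
  have : (x - z) / ε ≤ 0 := div_nonpos_of_nonpos_of_nonneg (by linarith) hε.le
  unfold smoothIndicator
  rw [min_eq_left (by linarith), max_eq_right zero_le_one]

lemma smoothIndicator_eq_zero {z ε x : ℝ} (hε : 0 < ε) (hx : z + ε ≤ x) :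
    smoothIndicator z ε x = 0 := by
  have : 1 ≤ (x - z) / ε := by rw [le_div_iff₀ hε]; linarith
  unfold smoothIndicator
  rw [max_eq_left]
  exact (min_le_right _ _).trans (by linarith)

lemma abs_smoothIndicator_sub_le {z ε : ℝ} (hε : 0 < ε) (x y : ℝ) :
    |smoothIndicator z ε x - smoothIndicator z ε y| ≤ |x - y| / ε := by
  unfold smoothIndicator
  calc _ ≤ |min 1 (1 - (x - z) / ε) - min 1 (1 - (y - z) / ε)| := by
        simpa only [max_comm (0 : ℝ)] using abs_max_sub_max_le_abs _ _ (0 : ℝ)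
    _ ≤ |(1 - (x - z) / ε) - (1 - (y - z) / ε)| := by
        refine (abs_min_sub_min_le_max _ _ _ _).trans ?_
        simp
    _ = |x - y| / ε := by
        rw [← abs_of_pos hε, ← abs_div, ← abs_neg, abs_of_pos hε]
        congr 1; ring

lemma gaussianReal_real_Ioc_le {a b : ℝ} (hab : a ≤ b) :
    (gaussianReal 0 1).real (Set.Ioc a b) ≤ b - a := by
  rw [measureReal_def, gaussianReal_apply_eq_integral _ one_ne_zero, ENNReal.toReal_ofReal
    (integral_nonneg fun x => gaussianPDFReal_nonneg _ _ _)]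
  calc _ ≤ ∫ x in Set.Ioc a b, (1 : ℝ) :=
        setIntegral_mono_on (integrable_gaussianPDFReal 0 1).integrableOn
          (integrableOn_const (by simp)) measurableSet_Ioc
          fun x _ => gaussianPDFReal_zero_one_le_one x
    _ = b - a := by simp [hab]

lemma gaussianReal_real_Iic_sub_le {a b : ℝ} (hab : a ≤ b) :
    (gaussianReal 0 1).real (Set.Iic b) - (gaussianReal 0 1).real (Set.Iic a) ≤ b - a := by
  have h : (gaussianReal 0 1).real (Set.Iic b) = (gaussianReal 0 1).real (Set.Iic a) +
      (gaussianReal 0 1).real (Set.Ioc a b) := by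
    rw [← Set.Iic_union_Ioc_eq_Iic hab, measureReal_union _ measurableSet_Ioc]
    rw [Set.disjoint_left]
    intro x hx hx'
    exact absurd hx'.1 (not_lt.2 hx)
  linarith [gaussianReal_real_Ioc_le hab]

lemma integral_smoothIndicator_mem_Icc {z ε : ℝ} (hε : 0 < ε) :
    ∫ x, smoothIndicator z ε x ∂(gaussianReal 0 1) ∈
      Set.Icc ((gaussianReal 0 1).real (Set.Iic z)) ((gaussianReal 0 1).real (Set.Iic (z + ε))) := by
  have hint : Integrable (smoothIndicator z ε) (gaussianReal 0 1) :=
    Integrable.of_bound (continuous_smoothIndicator z ε).aestronglyMeasurable 1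
      (Filter.Eventually.of_forall fun x => by
        have := smoothIndicator_mem_Icc z ε x
        rw [Real.norm_eq_abs, abs_le]; constructor <;> linarith [this.1, this.2])
  have hind : ∀ c : ℝ, Integrable ((Set.Iic c).indicator fun _ => (1 : ℝ)) (gaussianReal 0 1) :=
    fun c => (integrable_const 1).indicator measurableSet_Iic
  have hval : ∀ c : ℝ, ∫ x, (Set.Iic c).indicator (fun _ => (1 : ℝ)) x ∂(gaussianReal 0 1) =
      (gaussianReal 0 1).real (Set.Iic c) := fun c => by
    rw [integral_indicator measurableSet_Iic]; simp
  constructor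
  · rw [← hval]
    refine integral_mono (hind z) hint fun x => ?_
    by_cases hx : x ≤ z
    · simp [hx, smoothIndicator_eq_one hε hx]
    · simpa [hx] using (smoothIndicator_mem_Icc z ε x).1
  · rw [← hval]
    refine integral_mono hint (hind _) fun x => ?_
    by_cases hx : x ≤ z + ε
    · simpa [hx] using (smoothIndicator_mem_Icc z ε x).2
    · simp [hx, smoothIndicator_eq_zero hε (le_of_lt (not_le.1 hx))]

/-! ### A Kolmogorov bound for Stein couplings on a finite probability space -/

/-- The mean value inequality for `s ↦ f s - s f'(w)` reduces this to the oscillation of `f' = s f +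
h - N` near `w`. The product `s f` contributes `3 + 2|w|`, from `|f| ≤ 3` and `|f'| ≤ 2`. The
smoothed indicator contributes `ε⁻¹` only within distance `A` of its ramp. -/
lemma stein_solution_remainder_le {f : ℝ → ℝ} {z ε N A : ℝ} (hε : 0 < ε)
    (hN : N ∈ Set.Icc (0 : ℝ) 1)
    (hf : ∀ w, HasDerivAt f (w * f w + (smoothIndicator z ε w - N)) w)
    (hf3 : ∀ w, |f w| ≤ 3) (hf1 : ∀ w, |w * f w| ≤ 1) {w t : ℝ} (ht : |t| ≤ A) :
    |f (w + t) - f w - t * (w * f w + (smoothIndicator z ε w - N))| ≤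
      t ^ 2 * (3 + 2 * |w| + ε⁻¹ * ((if w ≤ z + ε + A then 1 else 0)
        - (if w ≤ z - A then 1 else 0))) := by
  set h := smoothIndicator z ε with hh
  have hA : 0 ≤ A := (abs_nonneg t).trans ht
  have hder : ∀ w, |w * f w + (h w - N)| ≤ 2 := by
    intro w
    have h1 := abs_le.1 (hf1 w)
    have h2 := smoothIndicator_mem_Icc z ε w
    rw [abs_le]
    constructor <;> linarith [h2.1, h2.2, hN.1, hN.2, h1.1, h1.2]
  have hlip : ∀ x y, |f y - f x| ≤ 2 * |y - x| := by
    intro x y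
    have := convex_univ.norm_image_sub_le_of_norm_hasDerivWithin_le (f := f)
      (C := 2) (x := x) (y := y) (fun x _ => (hf x).hasDerivWithinAt)
      (fun x _ => hder x) (Set.mem_univ _) (Set.mem_univ _)
    simpa [Real.norm_eq_abs] using this
  set J : ℝ := (if w ≤ z + ε + A then 1 else 0) - (if w ≤ z - A then 1 else 0) with hJ
  have hhs : ∀ s, |s - w| ≤ |t| → |h s - h w| ≤ |t| * (ε⁻¹ * J) := by
    intro s hs
    have hsA := abs_le.1 (hs.trans ht)
    by_cases h1 : w ≤ z - A
    · have h2 : w ≤ z + ε + A := by linarith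
      rw [hJ, if_pos h1, if_pos h2, hh, smoothIndicator_eq_one hε (by linarith),
        smoothIndicator_eq_one hε (by linarith)]
      simp
    · by_cases h2 : w ≤ z + ε + A
      · rw [hJ, if_neg h1, if_pos h2, sub_zero, mul_one, ← div_eq_mul_inv]
        exact (abs_smoothIndicator_sub_le hε s w).trans (by gcongr)
      · rw [hJ, if_neg h1, if_neg h2, hh, smoothIndicator_eq_zero hε (by linarith),
          smoothIndicator_eq_zero hε (by linarith)]
        simp
  have hmem : ∀ s ∈ Set.uIcc w (w + t), |s - w| ≤ |t| := by
    intro s hs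
    have := Set.abs_sub_left_of_mem_uIcc hs
    simpa using this
  have hbound : ∀ s ∈ Set.uIcc w (w + t),
      ‖(s * f s + (h s - N)) - (w * f w + (h w - N))‖ ≤ |t| * (3 + 2 * |w| + ε⁻¹ * J) := by
    intro s hs
    have h1 := hmem s hs
    rw [Real.norm_eq_abs]
    calc |(s * f s + (h s - N)) - (w * f w + (h w - N))|
        = |(s - w) * f s + w * (f s - f w) + (h s - h w)| := by congr 1; ring
      _ ≤ |(s - w) * f s| + |w * (f s - f w)| + |h s - h w| := abs_add_three _ _ _
      _ ≤ |t| * 3 + |w| * (2 * |t|) + |t| * (ε⁻¹ * J) := by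
          rw [abs_mul, abs_mul]
          have h2 := (hlip w s).trans (mul_le_mul_of_nonneg_left h1 two_pos.le)
          have h3 := hhs s h1
          gcongr
          exact hf3 s
      _ = _ := by ring
  have key := (convex_uIcc w (w + t)).norm_image_sub_le_of_norm_hasDerivWithin_le
    (f := fun s => f s - s * (w * f w + (h w - N)))
    (f' := fun s => (s * f s + (h s - N)) - (w * f w + (h w - N)))
    (fun s _ => ((hf s).sub ((hasDerivAt_id s).mul_const _ |>.congr_deriv
      (one_mul _))).hasDerivWithinAt) hbound Set.left_mem_uIcc Set.right_mem_uIcc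
  rw [Real.norm_eq_abs, Real.norm_eq_abs] at key
  calc _ = |f (w + t) - (w + t) * (w * f w + (h w - N)) - (f w - w * (w * f w + (h w - N)))| := by
        congr 1; ring
    _ ≤ _ := key
    _ = |t| * |t| * (3 + 2 * |w| + ε⁻¹ * J) := by rw [add_sub_cancel_left]; ring
    _ = _ := by rw [abs_mul_abs_self, sq]

section Coupling

variable {Ω ι : Type*} [Fintype Ω] [Fintype ι]

/-- The distribution function of `W` under the weights `p`. -/
def weightedCdf (p W : Ω → ℝ) (z : ℝ) : ℝ := ∑ ω, p ω * (if W ω ≤ z then 1 else 0)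

lemma weightedCdf_mem_Icc {p : Ω → ℝ} (hp : ∀ ω, 0 ≤ p ω) (hp1 : ∑ ω, p ω = 1) (W : Ω → ℝ)
    (z : ℝ) : weightedCdf p W z ∈ Set.Icc (0 : ℝ) 1 := by
  constructor
  · exact Finset.sum_nonneg fun ω _ => mul_nonneg (hp ω) (by split_ifs <;> norm_num)
  · rw [← hp1]
    exact Finset.sum_le_sum fun ω _ => mul_le_of_le_one_right (hp ω) (by split_ifs <;> norm_num)

/-- Comparison of `E h(W)` with its normal counterpart, for a smoothed indicator `h`. -/
lemma stein_coupling_smooth_bound {p W : Ω → ℝ} {W' G : ι → Ω → ℝ}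
    (hp : ∀ ω, 0 ≤ p ω) (hp1 : ∑ ω, p ω = 1)
    (hcoup : ∀ f : ℝ → ℝ, ∑ ω, p ω * (W ω * f (W ω)) =
      ∑ ω, p ω * ∑ i, G i ω * (f (W' i ω) - f (W ω)))
    (hW : ∑ ω, p ω * W ω ^ 2 ≤ 1)
    {A β D ε : ℝ} (hA : ∀ i ω, p ω ≠ 0 → |W' i ω - W ω| ≤ A)
    (hβ : ∀ ω, p ω ≠ 0 → ∑ i, |G i ω| * (W' i ω - W ω) ^ 2 ≤ β)
    (hD : ∑ ω, p ω * |1 - ∑ i, G i ω * (W' i ω - W ω)| ≤ D) (hA0 : 0 ≤ A) (hε : 0 < ε) (z : ℝ) :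
    |∑ ω, p ω * smoothIndicator z ε (W ω) - ∫ x, smoothIndicator z ε x ∂(gaussianReal 0 1)| ≤
      2 * D + β * (5 + ε⁻¹ * (weightedCdf p W (z + ε + A) - weightedCdf p W (z - A))) := by
  obtain ⟨f, hf, hf3, hf1⟩ := exists_stein_solution (continuous_smoothIndicator z ε)
    (smoothIndicator_mem_Icc z ε)
  have hNmem := integral_smoothIndicator_mem_Icc (z := z) hε
  set N := ∫ x, smoothIndicator z ε x ∂(gaussianReal 0 1) with hN
  have hN01 : N ∈ Set.Icc (0 : ℝ) 1 := ⟨measureReal_nonneg.trans hNmem.1,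
    hNmem.2.trans measureReal_le_one⟩
  set f' : ℝ → ℝ := fun w => w * f w + (smoothIndicator z ε w - N) with hf'
  have hf'2 : ∀ w, |f' w| ≤ 2 := by
    intro w
    have h1 := abs_le.1 (hf1 w)
    have h2 := smoothIndicator_mem_Icc z ε w
    rw [hf', abs_le]
    constructor <;> linarith [h2.1, h2.2, hN01.1, hN01.2, h1.1, h1.2]
  set R : ι → Ω → ℝ := fun i ω => f (W' i ω) - f (W ω) - (W' i ω - W ω) * f' (W ω) with hR
  set J : Ω → ℝ := fun ω => (if W ω ≤ z + ε + A then 1 else 0) - (if W ω ≤ z - A then 1 else 0)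
    with hJ
  have hJ0 : ∀ ω, 0 ≤ J ω := by
    intro ω
    simp only [hJ]
    split_ifs <;> first | (norm_num; done) | (exfalso; linarith)
  have hRle : ∀ i ω, p ω ≠ 0 → |R i ω| ≤ (W' i ω - W ω) ^ 2 * (3 + 2 * |W ω| + ε⁻¹ * J ω) := by
    intro i ω hω
    have := stein_solution_remainder_le hε hN01 hf hf3 hf1 (hA i ω hω) (w := W ω)
    rwa [add_sub_cancel] at this
  -- The Stein equation turns the difference into `E[f'(W) - W f(W)]`. The coupling identity,
  -- expanded to first order, then separates the second-order defect from the remainders `R`.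
  have hid : ∑ ω, p ω * smoothIndicator z ε (W ω) - N =
      ∑ ω, p ω * (f' (W ω) * (1 - ∑ i, G i ω * (W' i ω - W ω)))
        - ∑ ω, p ω * ∑ i, G i ω * R i ω := by
    have h1 : ∑ ω, p ω * smoothIndicator z ε (W ω) - N =
        ∑ ω, p ω * f' (W ω) - ∑ ω, p ω * (W ω * f (W ω)) := by
      have : N = ∑ ω, p ω * N := by rw [← Finset.sum_mul, hp1, one_mul]
      rw [this, ← Finset.sum_sub_distrib, ← Finset.sum_sub_distrib]
      refine Finset.sum_congr rfl fun ω _ => ?_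
      simp only [hf']
      ring
    rw [h1, hcoup f, ← Finset.sum_sub_distrib, ← Finset.sum_sub_distrib]
    refine Finset.sum_congr rfl fun ω _ => ?_
    have h2 : ∑ i, G i ω * (f (W' i ω) - f (W ω)) =
        (∑ i, G i ω * (W' i ω - W ω)) * f' (W ω) + ∑ i, G i ω * R i ω := by
      rw [Finset.sum_mul, ← Finset.sum_add_distrib]
      refine Finset.sum_congr rfl fun i _ => ?_
      simp only [hR]
      ring
    rw [h2]; ring
  have hb1 : |∑ ω, p ω * (f' (W ω) * (1 - ∑ i, G i ω * (W' i ω - W ω)))| ≤ 2 * D := by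
    calc _ ≤ ∑ ω, |p ω * (f' (W ω) * (1 - ∑ i, G i ω * (W' i ω - W ω)))| :=
          Finset.abs_sum_le_sum_abs _ _
      _ ≤ ∑ ω, 2 * (p ω * |1 - ∑ i, G i ω * (W' i ω - W ω)|) := by
          refine Finset.sum_le_sum fun ω _ => ?_
          rw [abs_mul, abs_mul, abs_of_nonneg (hp ω)]
          have := mul_le_mul_of_nonneg_right (hf'2 (W ω))
            (mul_nonneg (hp ω) (abs_nonneg (1 - ∑ i, G i ω * (W' i ω - W ω))))
          linarith
      _ ≤ 2 * D := by rw [← Finset.mul_sum]; linarith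
  have hβ0 : ∀ ω, 0 ≤ ∑ i, |G i ω| * (W' i ω - W ω) ^ 2 := fun ω =>
    Finset.sum_nonneg fun i _ => by positivity
  have hb2 : |∑ ω, p ω * ∑ i, G i ω * R i ω| ≤
      β * (5 + ε⁻¹ * (weightedCdf p W (z + ε + A) - weightedCdf p W (z - A))) := by
    calc _ ≤ ∑ ω, |p ω * ∑ i, G i ω * R i ω| := Finset.abs_sum_le_sum_abs _ _
      _ ≤ ∑ ω, p ω * (β * (4 + W ω ^ 2 + ε⁻¹ * J ω)) := by
          refine Finset.sum_le_sum fun ω _ => ?_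
          rcases eq_or_ne (p ω) 0 with hω | hω
          · simp [hω]
          rw [abs_mul, abs_of_nonneg (hp ω)]
          refine mul_le_mul_of_nonneg_left ?_ (hp ω)
          have hq : 0 ≤ ε⁻¹ * J ω := mul_nonneg (inv_nonneg.2 hε.le) (hJ0 ω)
          calc _ ≤ ∑ i, |G i ω * R i ω| := Finset.abs_sum_le_sum_abs _ _
            _ ≤ ∑ i, |G i ω| * (W' i ω - W ω) ^ 2 * (3 + 2 * |W ω| + ε⁻¹ * J ω) := by
                refine Finset.sum_le_sum fun i _ => ?_
                rw [abs_mul, mul_assoc]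
                exact mul_le_mul_of_nonneg_left (hRle i ω hω) (abs_nonneg _)
            _ = (∑ i, |G i ω| * (W' i ω - W ω) ^ 2) * (3 + 2 * |W ω| + ε⁻¹ * J ω) := by
                rw [Finset.sum_mul]
            _ ≤ β * (3 + 2 * |W ω| + ε⁻¹ * J ω) := by
                refine mul_le_mul_of_nonneg_right (hβ ω hω) ?_
                positivity
            _ ≤ β * (4 + W ω ^ 2 + ε⁻¹ * J ω) := by
                refine mul_le_mul_of_nonneg_left ?_ ((hβ0 ω).trans (hβ ω hω))
                -- Uses `2|W| ≤ 1 + W²`; the bound `E W² ≤ 1` later makes the constant `5`.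
                nlinarith [sq_nonneg (|W ω| - 1), sq_abs (W ω)]
      _ = β * (4 * (∑ ω, p ω) + ∑ ω, p ω * W ω ^ 2 + ε⁻¹ * ∑ ω, p ω * J ω) := by
          simp only [Finset.mul_sum, ← Finset.sum_add_distrib]
          refine Finset.sum_congr rfl fun ω _ => ?_
          ring
      _ = β * (4 + ∑ ω, p ω * W ω ^ 2 +
            ε⁻¹ * (weightedCdf p W (z + ε + A) - weightedCdf p W (z - A))) := by
          rw [hp1, mul_one]
          congr 3
          simp only [weightedCdf, hJ, ← Finset.sum_sub_distrib, mul_sub]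
      _ ≤ _ := by
          have hΩ : 0 ≤ β := by
            by_contra hneg
            have : ∑ ω, p ω ≤ 0 := Finset.sum_nonpos fun ω _ =>
              by_contra fun hω => hneg ((hβ0 ω).trans (hβ ω (ne_of_gt (not_le.1 hω))))
            linarith
          refine mul_le_mul_of_nonneg_left ?_ hΩ
          linarith
  rw [hid]
  exact (abs_sub _ _).trans (add_le_add hb1 hb2)

/-- Kolmogorov bound for a bounded Stein coupling on a finite probability space. -/
theorem stein_coupling_kolmogorov_bound {p W : Ω → ℝ} {W' G : ι → Ω → ℝ}
    (hp : ∀ ω, 0 ≤ p ω) (hp1 : ∑ ω, p ω = 1)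
    (hcoup : ∀ f : ℝ → ℝ, ∑ ω, p ω * (W ω * f (W ω)) =
      ∑ ω, p ω * ∑ i, G i ω * (f (W' i ω) - f (W ω)))
    (hW : ∑ ω, p ω * W ω ^ 2 ≤ 1)
    {A β D : ℝ} (hA : ∀ i ω, p ω ≠ 0 → |W' i ω - W ω| ≤ A)
    (hβ : ∀ ω, p ω ≠ 0 → ∑ i, |G i ω| * (W' i ω - W ω) ^ 2 ≤ β)
    (hD : ∑ ω, p ω * |1 - ∑ i, G i ω * (W' i ω - W ω)| ≤ D) (hA0 : 0 ≤ A) (hβ0 : 0 < β) (z : ℝ) :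
    |weightedCdf p W z - (gaussianReal 0 1).real (Set.Iic z)| ≤ 4 * D + 20 * β + A := by
  set Φ : ℝ → ℝ := fun z => (gaussianReal 0 1).real (Set.Iic z) with hΦ
  have hΦlip : ∀ a b, a ≤ b → Φ b - Φ a ≤ b - a := fun a b => gaussianReal_real_Iic_sub_le
  have hΦ01 : ∀ z, Φ z ∈ Set.Icc (0 : ℝ) 1 := fun z => ⟨measureReal_nonneg, measureReal_le_one⟩
  have hF01 := weightedCdf_mem_Icc hp hp1 W
  set F := weightedCdf p W with hF
  have hbdd : BddAbove (Set.range fun z => |F z - Φ z|) := by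
    refine ⟨1, ?_⟩
    rintro _ ⟨z, rfl⟩
    show |F z - Φ z| ≤ 1
    rw [abs_le]
    constructor <;> linarith [(hF01 z).1, (hF01 z).2, (hΦ01 z).1, (hΦ01 z).2]
  set K := ⨆ z, |F z - Φ z| with hK
  have hle : ∀ z, |F z - Φ z| ≤ K := le_ciSup hbdd
  -- With `β / ε = 1/4`, the term `2K` in the window probability returns as `K/2`, which can be
  -- moved to the left side.
  set ε := 4 * β with hεdef
  have hε : 0 < ε := by positivity
  set Q := 2 * D + β * (5 + ε⁻¹ * (2 * K + ε + 2 * A)) with hQ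
  have hsmooth : ∀ z, |∑ ω, p ω * smoothIndicator z ε (W ω)
      - ∫ x, smoothIndicator z ε x ∂(gaussianReal 0 1)| ≤ Q := by
    intro z
    refine (stein_coupling_smooth_bound hp hp1 hcoup hW hA hβ hD hA0 hε z).trans ?_
    rw [← hF]
    have h1 := (abs_le.1 (hle (z + ε + A))).2
    have h2 := (abs_le.1 (hle (z - A))).1
    have h3 := hΦlip (z - A) (z + ε + A) (by linarith)
    have h4 : F (z + ε + A) - F (z - A) ≤ 2 * K + ε + 2 * A := by linarith
    rw [hQ]
    gcongr
  have hFle : ∀ z, F z ≤ ∑ ω, p ω * smoothIndicator z ε (W ω) := by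
    intro z
    refine Finset.sum_le_sum fun ω _ => mul_le_mul_of_nonneg_left ?_ (hp ω)
    split_ifs with h
    · rw [smoothIndicator_eq_one hε h]
    · exact (smoothIndicator_mem_Icc z ε _).1
  have hleF : ∀ z, ∑ ω, p ω * smoothIndicator z ε (W ω) ≤ F (z + ε) := by
    intro z
    refine Finset.sum_le_sum fun ω _ => mul_le_mul_of_nonneg_left ?_ (hp ω)
    split_ifs with h
    · exact (smoothIndicator_mem_Icc z ε _).2
    · rw [smoothIndicator_eq_zero hε (le_of_lt (not_le.1 h))]
  have hpt : ∀ z, |F z - Φ z| ≤ ε + Q := by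
    intro z
    rw [abs_le]
    constructor
    · have h1 := (abs_le.1 (hsmooth (z - ε))).1
      have h2 := (integral_smoothIndicator_mem_Icc (z := z - ε) hε).1
      have h3 := hleF (z - ε)
      have h4 := hΦlip (z - ε) z (by linarith)
      simp only [sub_add_cancel] at h3
      simp only [hΦ] at h4 ⊢
      linarith
    · have h1 := (abs_le.1 (hsmooth z)).2
      have h2 := (integral_smoothIndicator_mem_Icc (z := z) hε).2
      have h3 := hFle z
      have h4 := hΦlip z (z + ε) (by linarith)
      simp only [hΦ] at h4 ⊢
      linarith
  have hKle : K ≤ ε + Q := ciSup_le hpt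
  have hQval : Q = 2 * D + 6 * β + K / 2 + A / 2 := by
    rw [hQ, hεdef]
    field_simp
    ring
  have := hle z
  rw [hεdef] at hKle
  linarith

end Coupling

/-! ### Expectation over a uniform random matching -/

section Matchings

variable {n : ℕ}

/-- The uniform weight on the set of matchings. -/
def matchWeight (n : ℕ) (σ : Equiv.Perm (Fin n)) : ℝ :=
  (matchings n).indicator (fun _ => ((matchings n).ncard : ℝ)⁻¹) σ

/-- The mean of `f` over the set of matchings. -/
def matchMean (f : Equiv.Perm (Fin n) → ℝ) : ℝ := ∑ σ, matchWeight n σ * f σ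

lemma matchWeight_nonneg (σ : Equiv.Perm (Fin n)) : 0 ≤ matchWeight n σ :=
  Set.indicator_nonneg (fun _ _ => by positivity) σ

lemma sum_matchWeight (hne : (matchings n).Nonempty) : ∑ σ, matchWeight n σ = 1 := by
  classical
  have hcard : ((matchings n).ncard : ℝ) ≠ 0 := by
    exact Nat.cast_ne_zero.2 (Set.ncard_ne_zero_of_mem hne.some_mem)
  unfold matchWeight
  rw [Finset.sum_indicator_eq_sum_filter, Finset.sum_const, nsmul_eq_mul]
  have : (Finset.univ.filter fun σ => σ ∈ matchings n).card = (matchings n).ncard := by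
    rw [Set.ncard_eq_toFinset_card']
    congr 1; ext; simp
  rw [this, mul_inv_cancel₀ hcard]

lemma matchWeight_eq_zero {σ : Equiv.Perm (Fin n)} (hσ : σ ∉ matchings n) : matchWeight n σ = 0 :=
  Set.indicator_of_notMem hσ _

lemma matchMean_congr {f g : Equiv.Perm (Fin n) → ℝ} (h : ∀ σ ∈ matchings n, f σ = g σ) :
    matchMean f = matchMean g := by
  refine Finset.sum_congr rfl fun σ _ => ?_
  by_cases hσ : σ ∈ matchings n
  · rw [h σ hσ]
  · rw [matchWeight_eq_zero hσ, zero_mul, zero_mul]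

lemma matchMean_mono {f g : Equiv.Perm (Fin n) → ℝ} (h : ∀ σ ∈ matchings n, f σ ≤ g σ) :
    matchMean f ≤ matchMean g := by
  refine Finset.sum_le_sum fun σ _ => ?_
  by_cases hσ : σ ∈ matchings n
  · exact mul_le_mul_of_nonneg_left (h σ hσ) (matchWeight_nonneg σ)
  · rw [matchWeight_eq_zero hσ, zero_mul, zero_mul]

lemma matchMean_add (f g : Equiv.Perm (Fin n) → ℝ) :
    matchMean (fun σ => f σ + g σ) = matchMean f + matchMean g := by
  simp only [matchMean, mul_add, Finset.sum_add_distrib]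

lemma matchMean_sub (f g : Equiv.Perm (Fin n) → ℝ) :
    matchMean (fun σ => f σ - g σ) = matchMean f - matchMean g := by
  simp only [matchMean, mul_sub, Finset.sum_sub_distrib]

lemma matchMean_const_mul (c : ℝ) (f : Equiv.Perm (Fin n) → ℝ) :
    matchMean (fun σ => c * f σ) = c * matchMean f := by
  simp only [matchMean, Finset.mul_sum]
  exact Finset.sum_congr rfl fun σ _ => by ring

lemma matchMean_const (hne : (matchings n).Nonempty) (c : ℝ) :
    matchMean (n := n) (fun _ => c) = c := by
  rw [matchMean, ← Finset.sum_mul, sum_matchWeight hne, one_mul]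

lemma matchMean_sum {ι : Type*} (s : Finset ι) (f : ι → Equiv.Perm (Fin n) → ℝ) :
    matchMean (fun σ => ∑ i ∈ s, f i σ) = ∑ i ∈ s, matchMean (f i) := by
  simp only [matchMean, Finset.mul_sum]
  exact Finset.sum_comm

lemma sq_matchMean_abs_le (hne : (matchings n).Nonempty) (f : Equiv.Perm (Fin n) → ℝ) :
    (matchMean fun σ => |f σ|) ^ 2 ≤ matchMean fun σ => f σ ^ 2 := by
  set m := matchMean fun σ => |f σ| with hm
  have h : 0 ≤ matchMean fun σ => (|f σ| - m) ^ 2 :=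
    Finset.sum_nonneg fun σ _ => mul_nonneg (matchWeight_nonneg σ) (sq_nonneg _)
  have h2 : (matchMean fun σ => (|f σ| - m) ^ 2) =
      (matchMean fun σ => f σ ^ 2) - 2 * m * m + m ^ 2 := by
    rw [← matchMean_const hne (m ^ 2)]
    nth_rw 4 [hm]
    rw [← matchMean_const_mul, ← matchMean_sub, ← matchMean_add]
    refine matchMean_congr fun σ _ => ?_
    rw [← sq_abs (f σ)]; ring
  rw [h2] at h
  nlinarith

/-- Conjugation of a permutation by the transposition of `a` and `k`. -/
def swapConj (a k : Fin n) (σ : Equiv.Perm (Fin n)) : Equiv.Perm (Fin n) :=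
  Equiv.swap a k * σ * Equiv.swap a k

lemma swapConj_apply (a k : Fin n) (σ : Equiv.Perm (Fin n)) (i : Fin n) :
    swapConj a k σ i = Equiv.swap a k (σ (Equiv.swap a k i)) := rfl

lemma swapConj_swapConj (a k : Fin n) (σ : Equiv.Perm (Fin n)) :
    swapConj a k (swapConj a k σ) = σ := by
  ext i; simp [swapConj_apply]

lemma apply_apply_of_mem {σ : Equiv.Perm (Fin n)} (hσ : σ ∈ matchings n) (i : Fin n) :
    σ (σ i) = i := by
  have h := congrArg (fun τ : Equiv.Perm (Fin n) => τ i) hσ.1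
  simpa [sq] using h

lemma swapConj_mem {σ : Equiv.Perm (Fin n)} (hσ : σ ∈ matchings n) (a k : Fin n) :
    swapConj a k σ ∈ matchings n := by
  constructor
  · ext i
    simp [sq, swapConj_apply, apply_apply_of_mem hσ]
  · intro i h
    rw [swapConj_apply, Equiv.swap_apply_eq_iff] at h
    exact hσ.2 _ h

lemma matchWeight_swapConj (a k : Fin n) (σ : Equiv.Perm (Fin n)) :
    matchWeight n (swapConj a k σ) = matchWeight n σ := by
  have : swapConj a k σ ∈ matchings n ↔ σ ∈ matchings n :=
    ⟨fun h => swapConj_swapConj a k σ ▸ swapConj_mem h a k, fun h => swapConj_mem h a k⟩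
  by_cases h : σ ∈ matchings n
  · rw [matchWeight, matchWeight, Set.indicator_of_mem h, Set.indicator_of_mem (this.2 h)]
  · rw [matchWeight_eq_zero h, matchWeight_eq_zero (mt this.1 h)]

/-- Conjugation by a transposition is an involution that maps matchings to matchings, so it
preserves the uniform weight. -/
lemma matchMean_swapConj (a k : Fin n) (f : Equiv.Perm (Fin n) → ℝ) :
    matchMean (fun σ => f (swapConj a k σ)) = matchMean f := by
  let E : Equiv.Perm (Fin n) ≃ Equiv.Perm (Fin n) :=
    ⟨swapConj a k, swapConj a k, swapConj_swapConj a k, swapConj_swapConj a k⟩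
  unfold matchMean
  rw [← Equiv.sum_comp E fun σ => matchWeight n σ * f σ]
  refine Finset.sum_congr rfl fun σ _ => ?_
  show _ = matchWeight n (swapConj a k σ) * f (swapConj a k σ)
  rw [matchWeight_swapConj]

/-- Averaging an exchangeable sum over all transpositions. -/
lemma card_mul_matchMean_sum (H : Fin n → Equiv.Perm (Fin n) → ℝ) :
    n * matchMean (fun σ => ∑ a, H a σ) =
      matchMean fun σ => ∑ a, ∑ k, H a (swapConj a k σ) := by
  simp only [matchMean_sum, matchMean_swapConj, Finset.sum_const, Finset.card_univ,
    Fintype.card_fin, nsmul_eq_mul, Finset.mul_sum]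

variable {σ : Equiv.Perm (Fin n)}

lemma swapConj_self (a : Fin n) (σ : Equiv.Perm (Fin n)) : swapConj a a σ = σ := by
  ext i; simp [swapConj_apply]

lemma swapConj_apply_partner (hσ : σ ∈ matchings n) (a : Fin n) : swapConj a (σ a) σ = σ := by
  ext i
  rw [swapConj_apply]
  by_cases h1 : i = a
  · subst h1; rw [Equiv.swap_apply_left, apply_apply_of_mem hσ, Equiv.swap_apply_left]
  by_cases h2 : i = σ a
  · subst h2; rw [Equiv.swap_apply_right, apply_apply_of_mem hσ, Equiv.swap_apply_right]
  · rw [Equiv.swap_apply_of_ne_of_ne h1 h2, Equiv.swap_apply_of_ne_of_ne]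
    · intro h; apply h2; rw [← h, apply_apply_of_mem hσ]
    · intro h; exact h1 (σ.injective h)

lemma swapConj_apply_left (hσ : σ ∈ matchings n) {a k : Fin n} (h : k ≠ σ a) :
    swapConj a k σ a = σ k := by
  rw [swapConj_apply, Equiv.swap_apply_left, Equiv.swap_apply_of_ne_of_ne _ (hσ.2 k)]
  intro h'; apply h; rw [← h', apply_apply_of_mem hσ]

lemma swapConj_apply_right (hσ : σ ∈ matchings n) {a k : Fin n} (h : k ≠ σ a) :
    swapConj a k σ k = σ a := by
  rw [swapConj_apply, Equiv.swap_apply_right, Equiv.swap_apply_of_ne_of_ne (hσ.2 a) h.symm]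

lemma swapConj_apply_partner_left (hσ : σ ∈ matchings n) {a k : Fin n} (h : k ≠ σ a) :
    swapConj a k σ (σ a) = k := by
  rw [swapConj_apply, Equiv.swap_apply_of_ne_of_ne (hσ.2 a) h.symm, apply_apply_of_mem hσ,
    Equiv.swap_apply_left]

lemma swapConj_apply_partner_right (hσ : σ ∈ matchings n) {a k : Fin n} (h : k ≠ σ a) :
    swapConj a k σ (σ k) = a := by
  rw [swapConj_apply, Equiv.swap_apply_of_ne_of_ne _ (hσ.2 k), apply_apply_of_mem hσ,
    Equiv.swap_apply_right]
  intro h'; apply h; rw [← h', apply_apply_of_mem hσ]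

lemma swapConj_apply_of_ne (hσ : σ ∈ matchings n) {a k i : Fin n} (h1 : i ≠ a) (h2 : i ≠ k)
    (h3 : i ≠ σ a) (h4 : i ≠ σ k) : swapConj a k σ i = σ i := by
  rw [swapConj_apply, Equiv.swap_apply_of_ne_of_ne h1 h2, Equiv.swap_apply_of_ne_of_ne]
  · intro h; apply h3; rw [← h, apply_apply_of_mem hσ]
  · intro h; apply h4; rw [← h, apply_apply_of_mem hσ]

/-- When `k` is neither `a` nor its partner, the two pairs are disjoint and the four points are
distinct. These are the only places where conjugation can alter `σ`. -/
lemma sum_eq_of_support_pairs (hσ : σ ∈ matchings n) {a k : Fin n} (hka : k ≠ a) (hkσ : k ≠ σ a)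
    {h : Fin n → ℝ} (h0 : ∀ i, i ≠ a → i ≠ k → i ≠ σ a → i ≠ σ k → h i = 0) :
    ∑ i, h i = h a + h k + h (σ a) + h (σ k) := by
  have e1 : a ≠ σ k := by rintro rfl; exact hkσ (apply_apply_of_mem hσ k).symm
  have e2 : σ a ≠ σ k := fun h => hka (σ.injective h).symm
  have e3 := (hσ.2 a).symm
  have e4 := (hσ.2 k).symm
  rw [← Finset.sum_subset (Finset.subset_univ {a, k, σ a, σ k})]
  · rw [Finset.sum_insert, Finset.sum_insert, Finset.sum_pair e2]
    · ring
    · simp [hkσ, e4]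
    · simp [hka.symm, e1, e3]
  · intro i _ hi
    simp only [Finset.mem_insert, Finset.mem_singleton, not_or] at hi
    exact h0 i hi.1 hi.2.1 hi.2.2.1 hi.2.2.2

/-- The mean of a linear matching statistic. -/
lemma matchMean_linear (hne : (matchings n).Nonempty) (c : Fin n → Fin n → ℝ) :
    ((n : ℝ) - 1) * matchMean (fun σ => ∑ a, c a (σ a)) = ∑ a, ∑ k, c a k - ∑ a, c a a := by
  have h := card_mul_matchMean_sum fun a (σ : Equiv.Perm (Fin n)) => c a (σ a)
  have h2 : (matchMean fun σ : Equiv.Perm (Fin n) => ∑ a, ∑ k, c a (swapConj a k σ a)) =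
      matchMean fun σ => (∑ a, ∑ k, c a k - ∑ a, c a a) + ∑ a, c a (σ a) := by
    refine matchMean_congr fun σ hσ => ?_
    rw [← Finset.sum_sub_distrib, ← Finset.sum_add_distrib]
    refine Finset.sum_congr rfl fun a _ => ?_
    -- The exceptional `k = σ a` keeps `c a (σ a)` where the generic formula would give `c a a`.
    -- This accounts for the diagonal term and for `n - 1` in place of `n`.
    have h3 : ∀ k, c a (swapConj a k σ a) =
        c a (σ k) + if k = σ a then c a (σ a) - c a a else 0 := by
      intro k
      split_ifs with hk
      · rw [hk, swapConj_apply_partner hσ, apply_apply_of_mem hσ]; ring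
      · rw [swapConj_apply_left hσ hk, add_zero]
    simp only [h3, Finset.sum_add_distrib, Finset.sum_ite_eq', Finset.mem_univ, if_true]
    rw [Equiv.sum_comp σ fun k => c a k]
    ring
  rw [h2, matchMean_add, matchMean_const hne] at h
  linarith

end Matchings

/-! ### Matching statistics of centered symmetric arrays -/

section Arrays

variable {n : ℕ}

/-- Symmetric arrays with zero diagonal and zero row sums. -/
structure IsCenteredArray (d : Fin n → Fin n → ℝ) : Prop where
  symm : ∀ i j, d i j = d j i
  diag : ∀ i, d i i = 0
  row : ∀ i, ∑ j, d i j = 0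

/-- The squared Euclidean norm of a row. -/
def rowSq (d : Fin n → Fin n → ℝ) (i : Fin n) : ℝ := ∑ j, d i j ^ 2

/-- The quadratic statistic `∑ d_{ij} d_{σ(i)σ(j)}`. -/
def crossStat (d : Fin n → Fin n → ℝ) (σ : Equiv.Perm (Fin n)) : ℝ :=
  ∑ i, ∑ j, d i j * d (σ i) (σ j)

/-- The error made when the row `σ'(a)` of `d` is replaced by the row `σ(k)` in
`∑ j, d_{aj} d_{σ'(a)σ'(j)}`, where `σ'` is the conjugate of `σ` by the transposition `(a k)`. -/
def crossError (d : Fin n → Fin n → ℝ) (σ : Equiv.Perm (Fin n)) (a k : Fin n) : ℝ :=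
  ∑ j, d a j * d (swapConj a k σ a) (swapConj a k σ j) - ∑ j, d a j * d (σ k) (σ j)

variable {d : Fin n → Fin n → ℝ} {σ : Equiv.Perm (Fin n)}

lemma rowSq_nonneg (d : Fin n → Fin n → ℝ) (i : Fin n) : 0 ≤ rowSq d i :=
  Finset.sum_nonneg fun _ _ => sq_nonneg _

lemma sum_rowSq_apply (d : Fin n → Fin n → ℝ) (σ : Equiv.Perm (Fin n)) :
    ∑ i, rowSq d (σ i) = ∑ i, ∑ j, d i j ^ 2 := Equiv.sum_comp σ (rowSq d)

lemma sum_apply_sq (d : Fin n → Fin n → ℝ) (σ : Equiv.Perm (Fin n)) (i : Fin n) :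
    ∑ j, d i (σ j) ^ 2 = rowSq d i := Equiv.sum_comp σ fun j => d i j ^ 2

lemma abs_mul_le_half_sq (x y : ℝ) : |x * y| ≤ (x ^ 2 + y ^ 2) / 2 := by
  rw [abs_mul, ← sq_abs x, ← sq_abs y]
  nlinarith [sq_nonneg (|x| - |y|)]

lemma sum_abs_mul_le (d : Fin n → Fin n → ℝ) (σ : Equiv.Perm (Fin n)) (a b : Fin n) :
    ∑ j, |d a j * d b (σ j)| ≤ (rowSq d a + rowSq d b) / 2 := by
  calc _ ≤ ∑ j, (d a j ^ 2 + d b (σ j) ^ 2) / 2 :=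
        Finset.sum_le_sum fun j _ => abs_mul_le_half_sq _ _
    _ = _ := by rw [← Finset.sum_div, Finset.sum_add_distrib, sum_apply_sq]; rfl

lemma abs_sum_mul_le (d : Fin n → Fin n → ℝ) (σ : Equiv.Perm (Fin n)) (a b : Fin n) :
    |∑ j, d a j * d b (σ j)| ≤ (rowSq d a + rowSq d b) / 2 :=
  (Finset.abs_sum_le_sum_abs _ _).trans (sum_abs_mul_le d σ a b)

lemma abs_crossStat_le (d : Fin n → Fin n → ℝ) (σ : Equiv.Perm (Fin n)) :
    |crossStat d σ| ≤ ∑ i, ∑ j, d i j ^ 2 := by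
  calc _ ≤ ∑ i, |∑ j, d i j * d (σ i) (σ j)| := Finset.abs_sum_le_sum_abs _ _
    _ ≤ ∑ i, (rowSq d i + rowSq d (σ i)) / 2 :=
        Finset.sum_le_sum fun i _ => abs_sum_mul_le d σ i (σ i)
    _ = _ := by
        rw [← Finset.sum_div, Finset.sum_add_distrib, sum_rowSq_apply]
        simp only [rowSq]; ring

namespace IsCenteredArray

lemma col (hd : IsCenteredArray d) (j : Fin n) : ∑ i, d i j = 0 := by
  rw [← hd.row j]; exact Finset.sum_congr rfl fun i _ => hd.symm i j

lemma row_apply (hd : IsCenteredArray d) (σ : Equiv.Perm (Fin n)) (i : Fin n) :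
    ∑ j, d i (σ j) = 0 := by
  rw [Equiv.sum_comp σ fun j => d i j, hd.row]

lemma matchingStat_swapConj_sub (hd : IsCenteredArray d) (hσ : σ ∈ matchings n) {a k : Fin n}
    (hk : k ≠ σ a) :
    matchingStat d (swapConj a k σ) - matchingStat d σ =
      2 * (d a (σ k) + d k (σ a) - d a (σ a) - d k (σ k)) := by
  by_cases hka : k = a
  · subst hka; rw [swapConj_self]; ring
  rw [matchingStat, matchingStat, ← Finset.sum_sub_distrib, sum_eq_of_support_pairs hσ hka hk]
  · rw [swapConj_apply_left hσ hk, swapConj_apply_right hσ hk, swapConj_apply_partner_left hσ hk,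
      swapConj_apply_partner_right hσ hk, apply_apply_of_mem hσ, apply_apply_of_mem hσ,
      hd.symm (σ a) k, hd.symm (σ a) a, hd.symm (σ k) a, hd.symm (σ k) k]
    ring
  · intro i h1 h2 h3 h4
    rw [swapConj_apply_of_ne hσ h1 h2 h3 h4, sub_self]

/-- The Stein coupling identity. -/
lemma stein_identity (hd : IsCenteredArray d) (f : ℝ → ℝ) :
    ((n : ℝ) - 1) * matchMean (fun σ => matchingStat d σ * f (matchingStat d σ)) =
      matchMean fun σ => ∑ a, ∑ k, d a (σ k) *
        (f (matchingStat d (swapConj a k σ)) - f (matchingStat d σ)) := by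
  have h := card_mul_matchMean_sum fun a (σ : Equiv.Perm (Fin n)) =>
    d a (σ a) * f (matchingStat d σ)
  have h1 : (fun σ : Equiv.Perm (Fin n) => ∑ a, d a (σ a) * f (matchingStat d σ)) =
      fun σ => matchingStat d σ * f (matchingStat d σ) := by
    ext σ; rw [← Finset.sum_mul]; rfl
  have h2 : (matchMean fun σ => ∑ a, ∑ k, d a (swapConj a k σ a) *
        f (matchingStat d (swapConj a k σ))) =
      matchMean fun σ => (∑ a, ∑ k, d a (σ k) *
        (f (matchingStat d (swapConj a k σ)) - f (matchingStat d σ))) +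
          matchingStat d σ * f (matchingStat d σ) := by
    refine matchMean_congr fun σ hσ => ?_
    rw [show matchingStat d σ * f (matchingStat d σ) =
      ∑ a, d a (σ a) * f (matchingStat d σ) by rw [← Finset.sum_mul]; rfl,
      ← Finset.sum_add_distrib]
    refine Finset.sum_congr rfl fun a _ => ?_
    -- Subtracting `f` at the old value is free because `∑_k d a (σ k) = 0`. At `k = σ a` the zero
    -- diagonal kills the generic term, and the surviving term supplies one copy of `V f(V)`.
    have h3 : ∀ k, d a (swapConj a k σ a) * f (matchingStat d (swapConj a k σ)) =
        d a (σ k) * (f (matchingStat d (swapConj a k σ)) - f (matchingStat d σ)) +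
          d a (σ k) * f (matchingStat d σ) +
          if k = σ a then d a (σ a) * f (matchingStat d σ) else 0 := by
      intro k
      split_ifs with hk
      · rw [hk, swapConj_apply_partner hσ, apply_apply_of_mem hσ, hd.diag]; ring
      · rw [swapConj_apply_left hσ hk]; ring
    simp only [h3, Finset.sum_add_distrib, Finset.sum_ite_eq', Finset.mem_univ, if_true]
    rw [← Finset.sum_mul, hd.row_apply]
    ring
  rw [h1, h2, matchMean_add] at h
  linarith

/-- Of the four terms in the jump of the statistic, two vanish by zero row and column sums. The
square gives `S`, and reindexing `k` by `σ` turns `d a (σ k) * d k (σ a)` into the summand of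
`crossStat`. -/
lemma sum_mul_matchingStat_sub (hd : IsCenteredArray d) (hσ : σ ∈ matchings n) :
    ∑ a, ∑ k, d a (σ k) * (matchingStat d (swapConj a k σ) - matchingStat d σ) =
      2 * (∑ i, ∑ j, d i j ^ 2 + crossStat d σ) := by
  have h1 : ∀ a k, d a (σ k) * (matchingStat d (swapConj a k σ) - matchingStat d σ) =
      2 * d a (σ k) ^ 2 + 2 * (d a (σ k) * d k (σ a)) - 2 * d a (σ a) * d a (σ k) -
        2 * d k (σ k) * d a (σ k) := by
    intro a k
    by_cases hk : k = σ a
    · rw [hk, swapConj_apply_partner hσ, apply_apply_of_mem hσ, hd.diag]; ring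
    · rw [hd.matchingStat_swapConj_sub hσ hk]; ring
  have h2 : ∑ a, ∑ k, d a (σ k) * d k (σ a) = crossStat d σ := by
    refine Finset.sum_congr rfl fun a _ => ?_
    rw [← Equiv.sum_comp σ]
    refine Finset.sum_congr rfl fun k _ => ?_
    rw [apply_apply_of_mem hσ, hd.symm (σ k)]
  have h3 : ∑ a, ∑ k, 2 * d k (σ k) * d a (σ k) = 0 := by
    rw [Finset.sum_comm]
    refine Finset.sum_eq_zero fun k _ => ?_
    rw [← Finset.mul_sum, hd.col, mul_zero]
  simp only [h1, Finset.sum_sub_distrib, Finset.sum_add_distrib, h3, ← Finset.mul_sum, h2,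
    sum_apply_sq, rowSq, hd.row_apply, mul_zero, Finset.sum_const_zero]
  ring

/-- Only the indices `j = a, k, σ a, σ k` contribute to the generic difference. The conditional term
repairs the case `k = σ a`, where `σ` does not move. -/
lemma crossError_eq (hd : IsCenteredArray d) (hσ : σ ∈ matchings n) (a k : Fin n) :
    crossError d σ a k =
      d a k * d (σ k) (σ a) + d a (σ a) * (d k (σ k) - d a (σ k))
        + d a (σ k) * (d a (σ k) - d k (σ k))
        + if k = σ a then ∑ j, d a j * d (σ a) (σ j) - ∑ j, d a j * d a (σ j)
            - 2 * d a (σ a) ^ 2 else 0 := by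
  unfold crossError
  by_cases hk : k = σ a
  · rw [if_pos hk, hk, swapConj_apply_partner hσ, apply_apply_of_mem hσ, hd.diag,
      hd.symm (σ a) a]
    ring
  rw [if_neg hk, add_zero]
  by_cases hka : k = a
  · subst hka; rw [swapConj_self, hd.diag]; ring
  rw [swapConj_apply_left hσ hk, ← Finset.sum_sub_distrib, sum_eq_of_support_pairs hσ hka hk]
  · rw [swapConj_apply_left hσ hk, swapConj_apply_right hσ hk, swapConj_apply_partner_left hσ hk,
      swapConj_apply_partner_right hσ hk, apply_apply_of_mem hσ, apply_apply_of_mem hσ,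
      hd.diag, hd.diag, hd.symm (σ k) k, hd.symm (σ k) a]
    ring
  · intro i h1 h2 h3 h4
    rw [swapConj_apply_of_ne hσ h1 h2 h3 h4, sub_self]

lemma sum_cross_row_eq_zero (hd : IsCenteredArray d) (σ : Equiv.Perm (Fin n)) :
    ∑ a, ∑ k, ∑ j, d a j * d (σ k) (σ j) = 0 := by
  refine Finset.sum_eq_zero fun a _ => ?_
  rw [Finset.sum_comm]
  refine Finset.sum_eq_zero fun j _ => ?_
  rw [← Finset.mul_sum, Equiv.sum_comp σ fun k => d k (σ j), hd.col, mul_zero]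

lemma sum_crossError (hd : IsCenteredArray d) (hσ : σ ∈ matchings n) :
    ∑ a, ∑ k, crossError d σ a k =
      2 * crossStat d σ + matchingStat d σ ^ 2 + ∑ i, ∑ j, d i j ^ 2
        - ∑ a, ∑ j, d a j * d a (σ j) - 2 * ∑ a, d a (σ a) ^ 2 := by
  have h1 : ∑ a, ∑ k, d a k * d (σ k) (σ a) = crossStat d σ :=
    Finset.sum_congr rfl fun a _ => Finset.sum_congr rfl fun k _ => by rw [hd.symm (σ k)]
  have h2 : ∑ a, d a (σ a) * ∑ k, d k (σ k) = matchingStat d σ ^ 2 := by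
    rw [← Finset.sum_mul, sq]; rfl
  have h4 : ∑ a, ∑ k, d a (σ k) * d k (σ k) = 0 := by
    rw [Finset.sum_comm]
    exact Finset.sum_eq_zero fun k _ => by rw [← Finset.sum_mul, hd.col, zero_mul]
  have h5 : ∑ a, ∑ k, d a (σ k) * d a (σ k) = ∑ i, ∑ j, d i j ^ 2 :=
    Finset.sum_congr rfl fun a _ => by simp only [← sq]; exact sum_apply_sq d σ a
  have h6 : ∑ a, ∑ j, d a j * d (σ a) (σ j) = crossStat d σ := rfl
  simp only [hd.crossError_eq hσ, mul_sub, Finset.sum_add_distrib, Finset.sum_sub_distrib,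
    Finset.sum_ite_eq', Finset.mem_univ, if_true, h1, h2, h4, h5, h6, ← Finset.mul_sum,
    hd.row_apply, mul_zero, Finset.sum_const_zero]
  ring

/-- Each product in `crossError_eq` is split by `|xy| ≤ (x² + y²)/2`. The generic terms total `3S +
2nT` with `T = ∑ d_{aσ(a)}²`, and the exceptional ones `2S + 2T`. -/
lemma sum_abs_crossError_le (hd : IsCenteredArray d) (hσ : σ ∈ matchings n) :
    ∑ a, ∑ k, |crossError d σ a k| ≤
      5 * ∑ i, ∑ j, d i j ^ 2 + (2 * n + 2) * ∑ a, d a (σ a) ^ 2 := by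
  set S := ∑ i, ∑ j, d i j ^ 2 with hS
  set T := ∑ a, d a (σ a) ^ 2 with hT
  have hle : ∀ a k, |crossError d σ a k| ≤
      (d a k ^ 2 + d (σ k) (σ a) ^ 2) / 2 + d a (σ a) ^ 2 + d k (σ k) ^ 2 + 2 * d a (σ k) ^ 2 +
        if k = σ a then rowSq d a + (rowSq d a + rowSq d (σ a)) / 2 + 2 * d a (σ a) ^ 2 else 0 := by
    intro a k
    rw [hd.crossError_eq hσ]
    refine (abs_add_le _ _).trans (add_le_add ?_ ?_)
    · have e1 := abs_le.1 (abs_mul_le_half_sq (d a k) (d (σ k) (σ a)))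
      rw [abs_le]
      constructor <;>
        nlinarith [e1.1, e1.2, sq_nonneg (d a (σ a) - d k (σ k)), sq_nonneg (d a (σ a) + d k (σ k)),
          sq_nonneg (d a (σ a) - d a (σ k)), sq_nonneg (d a (σ a) + d a (σ k)),
          sq_nonneg (d k (σ k) - d a (σ k)), sq_nonneg (d k (σ k) + d a (σ k)),
          sq_nonneg (d a (σ k))]
    · split_ifs
      · have e1 := abs_le.1 (abs_sum_mul_le d σ a (σ a))
        have e2 := abs_le.1 (abs_sum_mul_le d σ a a)
        rw [abs_le]
        constructor <;> linarith [e1.1, e1.2, e2.1, e2.2, sq_nonneg (d a (σ a)), rowSq_nonneg d a]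
      · simp
  have h1 : ∑ a, ∑ k, d (σ k) (σ a) ^ 2 = S := by
    rw [hS, ← sum_rowSq_apply d σ]
    refine Finset.sum_congr rfl fun a _ => ?_
    rw [← sum_apply_sq d σ]
    exact Finset.sum_congr rfl fun k _ => by rw [hd.symm]
  have h2 : ∑ a, ∑ k, d a (σ k) ^ 2 = S := Finset.sum_congr rfl fun a _ => sum_apply_sq d σ a
  have h3 : ∑ a, rowSq d a = S := rfl
  calc _ ≤ _ := Finset.sum_le_sum fun a _ => Finset.sum_le_sum fun k _ => hle a k
    _ = _ := by
        simp only [Finset.sum_add_distrib, Finset.sum_ite_eq', Finset.mem_univ, if_true,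
          ← Finset.sum_div, ← Finset.mul_sum, h1, h2, h3, sum_rowSq_apply, ← hS, ← hT,
          Finset.sum_const, Finset.card_univ, Fintype.card_fin, nsmul_eq_mul]
        ring

/-- A summand changes only if its row or column index lies among the four affected points. Both `σ`
and its conjugate permute those points, so the affected rows cost twice the four row norms; symmetry
doubles this again for the columns. -/
lemma abs_crossStat_swapConj_sub_le (hd : IsCenteredArray d) (hσ : σ ∈ matchings n)
    (a k : Fin n) :
    |crossStat d (swapConj a k σ) - crossStat d σ| ≤
      4 * (rowSq d a + rowSq d k + rowSq d (σ a) + rowSq d (σ k)) := by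
  have hR := rowSq_nonneg d
  by_cases hk : k = σ a
  · rw [hk, swapConj_apply_partner hσ, sub_self, abs_zero]
    linarith [hR a, hR (σ a), hR (σ (σ a))]
  by_cases hka : k = a
  · subst hka
    rw [swapConj_self, sub_self, abs_zero]
    linarith [hR k, hR (σ k)]
  set τ := swapConj a k σ with hτ
  let S : Finset (Fin n) := {a, k, σ a, σ k}
  set t : Fin n → Fin n → ℝ := fun i j => |d i j * d (τ i) (τ j) - d i j * d (σ i) (σ j)| with ht
  have hts : ∀ i j, t i j = t j i := fun i j => by
    simp only [ht]; rw [hd.symm i j, hd.symm (τ i), hd.symm (σ i)]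
  have hfix : ∀ i, i ∉ S → τ i = σ i := by
    intro i hi
    simp only [S, Finset.mem_insert, Finset.mem_singleton, not_or] at hi
    exact swapConj_apply_of_ne hσ hi.1 hi.2.1 hi.2.2.1 hi.2.2.2
  have hrow : ∀ i, ∑ j, t i j ≤ rowSq d i + (rowSq d (τ i) + rowSq d (σ i)) / 2 := by
    intro i
    calc _ ≤ ∑ j, (|d i j * d (τ i) (τ j)| + |d i j * d (σ i) (σ j)|) :=
          Finset.sum_le_sum fun j _ => abs_sub _ _
      _ ≤ _ := by
          rw [Finset.sum_add_distrib]
          linarith [sum_abs_mul_le d τ i (τ i), sum_abs_mul_le d σ i (σ i)]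
  have hpt : ∀ i j, t i j ≤ (if i ∈ S then t i j else 0) + (if j ∈ S then t j i else 0) := by
    intro i j
    have h0 : 0 ≤ t i j := abs_nonneg _
    rw [← hts i j]
    by_cases hi : i ∈ S <;> by_cases hj : j ∈ S <;> simp only [hi, hj, if_true, if_false]
    · linarith
    · linarith
    · linarith
    · simp only [ht]; rw [hfix i hi, hfix j hj]; simp
  have hfin : ∑ i, (if i ∈ S then ∑ j, t i j else 0) ≤
      2 * (rowSq d a + rowSq d k + rowSq d (σ a) + rowSq d (σ k)) := by
    rw [sum_eq_of_support_pairs hσ hka hk]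
    · have e1 := hrow a
      have e2 := hrow k
      have e3 := hrow (σ a)
      have e4 := hrow (σ k)
      rw [swapConj_apply_left hσ hk] at e1
      rw [swapConj_apply_right hσ hk] at e2
      rw [swapConj_apply_partner_left hσ hk, apply_apply_of_mem hσ] at e3
      rw [swapConj_apply_partner_right hσ hk, apply_apply_of_mem hσ] at e4
      simp only [S, Finset.mem_insert, Finset.mem_singleton, true_or, or_true, if_true]
      linarith
    · intro i h1 h2 h3 h4
      simp [S, h1, h2, h3, h4]
  calc _ = |∑ i, ∑ j, (d i j * d (τ i) (τ j) - d i j * d (σ i) (σ j))| := by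
        simp only [crossStat, Finset.sum_sub_distrib]
    _ ≤ ∑ i, ∑ j, t i j := (Finset.abs_sum_le_sum_abs _ _).trans
        (Finset.sum_le_sum fun i _ => Finset.abs_sum_le_sum_abs _ _)
    _ ≤ ∑ i, ∑ j, ((if i ∈ S then t i j else 0) + (if j ∈ S then t j i else 0)) :=
        Finset.sum_le_sum fun i _ => Finset.sum_le_sum fun j _ => hpt i j
    _ = 2 * ∑ i, (if i ∈ S then ∑ j, t i j else 0) := by
        simp only [Finset.sum_add_distrib]
        rw [Finset.sum_comm (f := fun i j => if j ∈ S then t j i else 0), two_mul]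
        congr 1 <;>
        · refine Finset.sum_congr rfl fun i _ => ?_
          split_ifs <;> simp
    _ ≤ _ := by linarith

end IsCenteredArray

end Arrays

/-! ### Moments of the linear and quadratic statistics, and the centering of `e`. -/

section Moments

variable {n : ℕ} {d : Fin n → Fin n → ℝ}

namespace IsCenteredArray

lemma matchMean_sum_sq (hd : IsCenteredArray d) (hne : (matchings n).Nonempty) :
    ((n : ℝ) - 1) * matchMean (fun σ => ∑ a, d a (σ a) ^ 2) = ∑ i, ∑ j, d i j ^ 2 := by
  rw [matchMean_linear hne fun a b => d a b ^ 2]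
  simp [hd.diag]

/-- With the sums exchanged this is a linear statistic of the Gram array `∑_a d_{aj} d_{ak}`, whose
total is zero and whose diagonal sum is `S`. -/
lemma matchMean_sum_mul_apply (hd : IsCenteredArray d) (hne : (matchings n).Nonempty) :
    ((n : ℝ) - 1) * matchMean (fun σ => ∑ a, ∑ j, d a j * d a (σ j)) =
      -∑ i, ∑ j, d i j ^ 2 := by
  have h := matchMean_linear hne fun j k => ∑ a, d a j * d a k
  have h1 : (fun σ : Equiv.Perm (Fin n) => ∑ a, ∑ j, d a j * d a (σ j)) =
      fun σ => ∑ j, ∑ a, d a j * d a (σ j) := funext fun σ => Finset.sum_comm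
  have h2 : ∑ j, ∑ k, ∑ a, d a j * d a k = 0 := by
    refine Finset.sum_eq_zero fun j _ => ?_
    rw [Finset.sum_comm]
    exact Finset.sum_eq_zero fun a _ => by rw [← Finset.mul_sum, hd.row, mul_zero]
  have h3 : ∑ j, ∑ a, d a j * d a j = ∑ i, ∑ j, d i j ^ 2 := by
    rw [Finset.sum_comm]; simp only [sq]
  rw [h1, h, h2, h3, zero_sub]

lemma matchMean_matchingStat_sq_eq (hd : IsCenteredArray d) (hne : (matchings n).Nonempty) :
    ((n : ℝ) - 1) * matchMean (fun σ => matchingStat d σ ^ 2) =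
      2 * (∑ i, ∑ j, d i j ^ 2 + matchMean (crossStat d)) := by
  have h := hd.stein_identity fun x => x
  simp only [← sq] at h
  rw [h, matchMean_congr fun σ hσ => hd.sum_mul_matchingStat_sub hσ, matchMean_const_mul,
    matchMean_add, matchMean_const hne]

/-- Averaging over transpositions leaves only `crossError`, whose sum involves `B`, `V²` and linear
statistics. As `E V²` is itself affine in `E B`, a linear equation for `E B` results. -/
lemma matchMean_crossStat (hd : IsCenteredArray d) (hne : (matchings n).Nonempty) (hn : 4 ≤ n) :
    ((n : ℝ) - 3) * matchMean (crossStat d) = ∑ i, ∑ j, d i j ^ 2 := by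
  have hn' : (4 : ℝ) ≤ n := by exact_mod_cast hn
  have h := card_mul_matchMean_sum fun a (σ : Equiv.Perm (Fin n)) => ∑ j, d a j * d (σ a) (σ j)
  have h1 : (matchMean fun σ : Equiv.Perm (Fin n) =>
      ∑ a, ∑ k, ∑ j, d a j * d (swapConj a k σ a) (swapConj a k σ j)) =
      matchMean fun σ => 2 * crossStat d σ + matchingStat d σ ^ 2 + ∑ i, ∑ j, d i j ^ 2
        - ∑ a, ∑ j, d a j * d a (σ j) - 2 * ∑ a, d a (σ a) ^ 2 := by
    refine matchMean_congr fun σ hσ => ?_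
    rw [← hd.sum_crossError hσ]
    simp only [crossError, Finset.sum_sub_distrib, hd.sum_cross_row_eq_zero, sub_zero]
  rw [h1, matchMean_sub, matchMean_sub, matchMean_add, matchMean_add, matchMean_const hne,
    matchMean_const_mul, matchMean_const_mul] at h
  change (n : ℝ) * matchMean (crossStat d) = 2 * matchMean (crossStat d) + _ + _ - _ - _ at h
  have e1 := hd.matchMean_sum_sq hne
  have e2 := hd.matchMean_sum_mul_apply hne
  have e3 := hd.matchMean_matchingStat_sq_eq hne
  set S := ∑ i, ∑ j, d i j ^ 2
  set B := matchMean (crossStat d)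
  -- Clearing the denominator `n - 1` leaves a common factor `n`.
  have key : (n : ℝ) * (((n : ℝ) - 3) * B - S) = 0 := by
    linear_combination ((n : ℝ) - 1) * h + e3 - e2 - 2 * e1
  rcases mul_eq_zero.1 key with h0 | h0 <;> linarith

/-- The variance of the centered matching statistic. -/
lemma matchMean_matchingStat_sq (hd : IsCenteredArray d) (hne : (matchings n).Nonempty)
    (hn : 4 ≤ n) :
    matchMean (fun σ => matchingStat d σ ^ 2) =
      2 * ((n : ℝ) - 2) / (((n : ℝ) - 1) * ((n : ℝ) - 3)) * ∑ i, ∑ j, d i j ^ 2 := by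
  have hn' : (4 : ℝ) ≤ n := by exact_mod_cast hn
  have h1 := hd.matchMean_matchingStat_sq_eq hne
  have h2 := hd.matchMean_crossStat hne hn
  have e1 : (n : ℝ) - 1 ≠ 0 := by linarith
  have e3 : (n : ℝ) - 3 ≠ 0 := by linarith
  rw [div_mul_eq_mul_div, eq_div_iff (mul_ne_zero e1 e3)]
  linear_combination ((n : ℝ) - 3) * h1 + 2 * h2

lemma sum_abs_mul_crossStat_sub_le (hd : IsCenteredArray d) {σ : Equiv.Perm (Fin n)}
    (hσ : σ ∈ matchings n) :
    ∑ a, ∑ k, |∑ j, d a j * d (σ k) (σ j)| * |crossStat d (swapConj a k σ) - crossStat d σ| ≤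
      16 * n * ∑ a, rowSq d a ^ 2 := by
  have hR := rowSq_nonneg d
  have hpt : ∀ a k, |∑ j, d a j * d (σ k) (σ j)| *
      |crossStat d (swapConj a k σ) - crossStat d σ| ≤
        6 * rowSq d a ^ 2 + 6 * rowSq d (σ k) ^ 2 + 2 * rowSq d k ^ 2 + 2 * rowSq d (σ a) ^ 2 := by
    intro a k
    refine (mul_le_mul (abs_sum_mul_le d σ a (σ k)) (hd.abs_crossStat_swapConj_sub_le hσ a k)
      (abs_nonneg _) (by linarith [hR a, hR (σ k)])).trans ?_
    nlinarith [sq_nonneg (rowSq d a - rowSq d (σ k)), sq_nonneg (rowSq d a - rowSq d k),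
      sq_nonneg (rowSq d a - rowSq d (σ a)), sq_nonneg (rowSq d (σ k) - rowSq d k),
      sq_nonneg (rowSq d (σ k) - rowSq d (σ a))]
  have hperm : ∑ a, rowSq d (σ a) ^ 2 = ∑ a, rowSq d a ^ 2 :=
    Equiv.sum_comp σ fun a => rowSq d a ^ 2
  calc _ ≤ _ := Finset.sum_le_sum fun a _ => Finset.sum_le_sum fun k _ => hpt a k
    _ = _ := by
        simp only [Finset.sum_add_distrib, ← Finset.mul_sum, hperm, Finset.sum_const,
          Finset.card_univ, Fintype.card_fin, nsmul_eq_mul]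
        ring

lemma sum_rowSq_sq_le (d : Fin n → Fin n → ℝ) :
    ∑ a, rowSq d a ^ 2 ≤ n * ∑ i, ∑ j, d i j ^ 4 := by
  rw [Finset.mul_sum]
  refine Finset.sum_le_sum fun a _ => ?_
  have := sq_sum_le_card_mul_sum_sq (s := Finset.univ) (f := fun j => d a j ^ 2)
  simpa [rowSq, ← pow_mul] using this

lemma sq_sum_sq_le (d : Fin n → Fin n → ℝ) :
    (∑ i, ∑ j, d i j ^ 2) ^ 2 ≤ n * ∑ a, rowSq d a ^ 2 := by
  have := sq_sum_le_card_mul_sum_sq (s := Finset.univ) (f := rowSq d)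
  simpa [rowSq] using this

/-- The second moment of the quadratic statistic. -/
lemma matchMean_crossStat_sq_le (hd : IsCenteredArray d) (hne : (matchings n).Nonempty)
    (hn : 10 ≤ n) :
    matchMean (fun σ => crossStat d σ ^ 2) ≤ 24 * n * ∑ i, ∑ j, d i j ^ 4 := by
  have hn' : (10 : ℝ) ≤ n := by exact_mod_cast hn
  set S := ∑ i, ∑ j, d i j ^ 2 with hS
  have hS0 : 0 ≤ S := Finset.sum_nonneg fun _ _ => Finset.sum_nonneg fun _ _ => sq_nonneg _
  set g : Equiv.Perm (Fin n) → Fin n → Fin n → ℝ := fun σ a k => ∑ j, d a j * d (σ k) (σ j) with hg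
  have h := card_mul_matchMean_sum fun a (σ : Equiv.Perm (Fin n)) =>
    (∑ j, d a j * d (σ a) (σ j)) * crossStat d σ
  have h0 : (fun σ : Equiv.Perm (Fin n) => ∑ a, (∑ j, d a j * d (σ a) (σ j)) * crossStat d σ) =
      fun σ => crossStat d σ ^ 2 := by
    ext σ; rw [← Finset.sum_mul, sq]; rfl
  have h1 : (matchMean fun σ : Equiv.Perm (Fin n) =>
      ∑ a, ∑ k, (∑ j, d a j * d (swapConj a k σ a) (swapConj a k σ j)) *
        crossStat d (swapConj a k σ)) ≤
      matchMean fun σ => 16 * n * (∑ a, rowSq d a ^ 2) + S * (5 * S) +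
        S * (2 * n + 2) * ∑ a, d a (σ a) ^ 2 := by
    refine matchMean_mono fun σ hσ => ?_
    -- Three parts: the change of `crossStat` under the swap, the replacement error, and a main term
    -- whose double sum vanishes because the columns of `d` sum to zero.
    have e1 : ∀ a k, (∑ j, d a j * d (swapConj a k σ a) (swapConj a k σ j)) *
        crossStat d (swapConj a k σ) =
        g σ a k * (crossStat d (swapConj a k σ) - crossStat d σ) +
          crossError d σ a k * crossStat d (swapConj a k σ) + g σ a k * crossStat d σ := by
      intro a k; simp only [crossError, hg]; ring
    have e2 : ∑ a, ∑ k, g σ a k * crossStat d σ = 0 := by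
      simp only [← Finset.sum_mul]
      rw [hd.sum_cross_row_eq_zero, zero_mul]
    have e3 : ∑ a, ∑ k, g σ a k * (crossStat d (swapConj a k σ) - crossStat d σ) ≤
        16 * n * (∑ a, rowSq d a ^ 2) := by
      refine le_trans (Finset.sum_le_sum fun a _ => Finset.sum_le_sum fun k _ => ?_)
        (hd.sum_abs_mul_crossStat_sub_le hσ)
      rw [← abs_mul]; exact le_abs_self _
    have e4 : ∑ a, ∑ k, crossError d σ a k * crossStat d (swapConj a k σ) ≤
        S * (5 * S + (2 * n + 2) * ∑ a, d a (σ a) ^ 2) := by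
      refine le_trans ?_ (mul_le_mul_of_nonneg_left (hd.sum_abs_crossError_le hσ) hS0)
      simp only [Finset.mul_sum]
      refine Finset.sum_le_sum fun a _ => Finset.sum_le_sum fun k _ => ?_
      refine (le_abs_self _).trans ?_
      rw [abs_mul, mul_comm]
      exact mul_le_mul_of_nonneg_right (abs_crossStat_le d _) (abs_nonneg _)
    simp only [e1, Finset.sum_add_distrib, e2]
    linarith
  rw [h0] at h
  rw [← h, matchMean_add, matchMean_const hne, matchMean_const_mul] at h1
  have e1 := hd.matchMean_sum_sq hne
  rw [← hS] at e1
  set T := matchMean fun σ => ∑ a, d a (σ a) ^ 2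
  have hT0 : 0 ≤ T := Finset.sum_nonneg fun σ _ => mul_nonneg (matchWeight_nonneg σ)
    (Finset.sum_nonneg fun _ _ => sq_nonneg _)
  have e2 : (2 * n + 2) * T ≤ 3 * S := by rw [← e1]; nlinarith
  have e3 := mul_le_mul_of_nonneg_left e2 hS0
  have e4 := sum_rowSq_sq_le d
  have e5 := sq_sum_sq_le d
  rw [← hS] at e5
  have e6 := mul_le_mul_of_nonneg_left e4 (by positivity : (0 : ℝ) ≤ n)
  have hn0 : (0 : ℝ) < n := by linarith
  refine le_of_mul_le_mul_left ?_ hn0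
  -- Let `R = ∑ rowSq²`. The bound is `16 n R + 5S² + 3S²`, and `S² ≤ n R` and `R ≤ n ∑ d⁴` make it
  -- `24 n² ∑ d⁴`.
  nlinarith

end IsCenteredArray

/-- The array `centered e` of a symmetric array with zero diagonal is doubly centered. -/
lemma isCenteredArray_centered {e : Fin n → Fin n → ℝ} (hn : 3 ≤ n)
    (he : ∀ i j, e i j = e j i) (he0 : ∀ i, e i i = 0) : IsCenteredArray (centered e) := by
  have hn' : (3 : ℝ) ≤ n := by exact_mod_cast hn
  have hcol : ∀ j, colSum e j = rowSum e j := fun j => Finset.sum_congr rfl fun i _ => he i j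
  refine ⟨fun i j => ?_, fun i => by simp [centered], fun i => ?_⟩
  · by_cases h : i = j
    · rw [h]
    · rw [centered, centered, if_neg h, if_neg (Ne.symm h), he i j, hcol, hcol]; ring
  · have h1 : ∀ j, centered e i j = (e i j - rowSum e i / ((n : ℝ) - 2) -
        rowSum e j / ((n : ℝ) - 2) + totalSum e / (((n : ℝ) - 1) * ((n : ℝ) - 2))) -
        if j = i then -2 * rowSum e i / ((n : ℝ) - 2) +
          totalSum e / (((n : ℝ) - 1) * ((n : ℝ) - 2)) else 0 := by
      intro j
      by_cases h : i = j
      · subst h; simp only [centered, if_true, he0]; ring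
      · rw [centered, if_neg h, if_neg (Ne.symm h), hcol, sub_zero]
    have h2 : ∑ j, rowSum e j = totalSum e := rfl
    have h3 : ∑ j, e i j = rowSum e i := rfl
    simp only [h1, Finset.sum_sub_distrib, Finset.sum_add_distrib, Finset.sum_ite_eq',
      Finset.mem_univ, if_true, ← Finset.sum_div, h2, h3, Finset.sum_const, Finset.card_univ,
      Fintype.card_fin, nsmul_eq_mul]
    have e1 : (n : ℝ) - 1 ≠ 0 := by linarith
    have e2 : (n : ℝ) - 2 ≠ 0 := by linarith
    field_simp
    ring

lemma matchingStat_centered {e : Fin n → Fin n → ℝ} (hn : 3 ≤ n) (he : ∀ i j, e i j = e j i)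
    {σ : Equiv.Perm (Fin n)} (hσ : σ ∈ matchings n) :
    matchingStat (centered e) σ = matchingStat e σ - totalSum e / ((n : ℝ) - 1) := by
  have hn' : (3 : ℝ) ≤ n := by exact_mod_cast hn
  have hcol : ∀ j, colSum e j = rowSum e j := fun j => Finset.sum_congr rfl fun i _ => he i j
  have h1 : ∀ i, centered e i (σ i) = e i (σ i) - rowSum e i / ((n : ℝ) - 2) -
        rowSum e (σ i) / ((n : ℝ) - 2) + totalSum e / (((n : ℝ) - 1) * ((n : ℝ) - 2)) :=
    fun i => by rw [centered, if_neg (hσ.2 i).symm, hcol]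
  have h2 : ∑ j, rowSum e j = totalSum e := rfl
  have h3 : ∑ j, rowSum e (σ j) = totalSum e := Equiv.sum_comp σ (rowSum e)
  simp only [matchingStat, h1, Finset.sum_sub_distrib, Finset.sum_add_distrib, ← Finset.sum_div,
    h2, h3, Finset.sum_const, Finset.card_univ, Fintype.card_fin, nsmul_eq_mul]
  have e1 : (n : ℝ) - 1 ≠ 0 := by linarith
  have e2 : (n : ℝ) - 2 ≠ 0 := by linarith
  field_simp
  ring

/-- The centered array is orthogonal to row functions, column functions and constants, so `∑ d² = ∑
d e`. Expanding one factor `d` leaves only sums in `e`. -/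
lemma sum_sq_centered {e : Fin n → Fin n → ℝ} (hn : 3 ≤ n) (he : ∀ i j, e i j = e j i)
    (he0 : ∀ i, e i i = 0) :
    ((n : ℝ) - 2) * ∑ i, ∑ j, centered e i j ^ 2 =
      ((n : ℝ) - 2) * (∑ i, ∑ k, e i k ^ 2) + 1 / ((n : ℝ) - 1) * totalSum e ^ 2
          - 2 * ∑ i, rowSum e i ^ 2 := by
  have hn' : (3 : ℝ) ≤ n := by exact_mod_cast hn
  have hd := isCenteredArray_centered hn he he0
  have hcol : ∀ j, colSum e j = rowSum e j := fun j => Finset.sum_congr rfl fun i _ => he i j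
  set t := totalSum e / (((n : ℝ) - 1) * ((n : ℝ) - 2)) with ht
  have h1 : ∀ i j, centered e i j ^ 2 = e i j ^ 2 - e i j * rowSum e i / ((n : ℝ) - 2) -
      e i j * rowSum e j / ((n : ℝ) - 2) + e i j * t -
      centered e i j * (rowSum e i / ((n : ℝ) - 2)) -
      centered e i j * (rowSum e j / ((n : ℝ) - 2)) + centered e i j * t := by
    intro i j
    by_cases h : i = j
    · subst h; rw [hd.diag, he0]; ring
    · rw [centered, if_neg h, hcol]; ring
  have h2 : ∑ i, ∑ j, centered e i j * (rowSum e i / ((n : ℝ) - 2)) = 0 :=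
    Finset.sum_eq_zero fun i _ => by rw [← Finset.sum_mul, hd.row, zero_mul]
  have h3 : ∑ i, ∑ j, centered e i j * (rowSum e j / ((n : ℝ) - 2)) = 0 := by
    rw [Finset.sum_comm]
    exact Finset.sum_eq_zero fun i _ => by rw [← Finset.sum_mul, hd.col, zero_mul]
  have h4 : ∑ i, ∑ j, centered e i j * t = 0 :=
    Finset.sum_eq_zero fun i _ => by rw [← Finset.sum_mul, hd.row, zero_mul]
  have h5 : ∑ i, ∑ j, e i j * rowSum e i / ((n : ℝ) - 2) =
      (∑ i, rowSum e i ^ 2) / ((n : ℝ) - 2) := by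
    rw [Finset.sum_div]
    exact Finset.sum_congr rfl fun i _ => by rw [← Finset.sum_div, ← Finset.sum_mul, sq]; rfl
  have h6 : ∑ i, ∑ j, e i j * rowSum e j / ((n : ℝ) - 2) =
      (∑ i, rowSum e i ^ 2) / ((n : ℝ) - 2) := by
    rw [Finset.sum_comm, ← h5]
    exact Finset.sum_congr rfl fun i _ => Finset.sum_congr rfl fun j _ => by rw [he]
  have h7 : ∑ i, ∑ j, e i j * t = totalSum e * t := by
    simp only [← Finset.sum_mul]; rfl
  simp only [h1, Finset.sum_sub_distrib, Finset.sum_add_distrib, h2, h3, h4, h5, h6, h7]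
  have e1 : (n : ℝ) - 1 ≠ 0 := by linarith
  have e2 : (n : ℝ) - 2 ≠ 0 := by linarith
  rw [ht]
  field_simp
  ring

lemma abs_sub_le_maxDiff (d : Fin n → Fin n → ℝ) (i j k l : Fin n) :
    |d i j - d k l| ≤ maxDiff d :=
  le_ciSup (f := fun p : (Fin n × Fin n) × (Fin n × Fin n) => |d p.1.1 p.1.2 - d p.2.1 p.2.2|)
    (Set.finite_range _).bddAbove ((i, j), (k, l))

end Moments

/-! ### Transfer from the random matching to weighted finite sums. -/

section Law

variable {n : ℕ} {Ω : Type*} [MeasurableSpace Ω] {P : Measure Ω}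
  {π : Ω → Equiv.Perm (Fin n)}

/-- On an empty set `uniformOn` is the zero measure, which cannot be the law of anything under a
probability measure. -/
lemma nonempty_matchings_of_hasLaw [IsProbabilityMeasure P]
    (hπ : HasLaw π (uniformOn (matchings n)) P) : (matchings n).Nonempty := by
  by_contra h
  have h1 : IsProbabilityMeasure (uniformOn (matchings n)) := hπ.isProbabilityMeasure_iff.1 ‹_›
  have h2 : uniformOn (matchings n) = 0 := by simp [Set.not_nonempty_iff_eq_empty.1 h]
  exact IsProbabilityMeasure.ne_zero _ h2

lemma uniformOn_matchings_real_singleton (σ : Equiv.Perm (Fin n)) :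
    (uniformOn (matchings n)).real {σ} = matchWeight n σ := by
  classical
  have hfin : (matchings n).Finite := Set.toFinite _
  have h : matchings n = (hfin.toFinset : Set (Equiv.Perm (Fin n))) := by simp
  have h2 : ({σ} : Set (Equiv.Perm (Fin n))) = (({σ} : Finset (Equiv.Perm (Fin n))) : Set _) := by
    simp
  rw [measureReal_def, matchWeight, Set.ncard_eq_toFinset_card _ hfin]
  by_cases hσ : σ ∈ matchings n
  · rw [Set.indicator_of_mem hσ]
    conv_lhs => rw [h, h2, uniformOn_apply_finset]
    rw [Finset.inter_singleton_of_mem (by simpa using hσ)]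
    simp
  · rw [Set.indicator_of_notMem hσ]
    conv_lhs => rw [h, h2, uniformOn_apply_finset]
    rw [Finset.inter_singleton_of_notMem (by simpa using hσ)]
    simp

lemma integral_comp_eq_matchMean [IsProbabilityMeasure P]
    (hπ : HasLaw π (uniformOn (matchings n)) P) (g : Equiv.Perm (Fin n) → ℝ) :
    ∫ ω, g (π ω) ∂P = matchMean g := by
  have hprob : IsProbabilityMeasure (uniformOn (matchings n)) := hπ.isProbabilityMeasure_iff.1 ‹_›
  have h := hπ.integral_comp (f := g) (measurable_of_finite g).aestronglyMeasurable
  simp only [Function.comp_apply] at h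
  rw [h, integral_fintype Integrable.of_finite]
  simp only [uniformOn_matchings_real_singleton, smul_eq_mul, matchMean]

lemma measureReal_comp_le_eq_weightedCdf [IsProbabilityMeasure P]
    (hπ : HasLaw π (uniformOn (matchings n)) P) (g : Equiv.Perm (Fin n) → ℝ) (w : ℝ) :
    P.real {ω | g (π ω) ≤ w} = weightedCdf (matchWeight n) g w := by
  have hm : NullMeasurableSet {ω | g (π ω) ≤ w} P := hπ.aemeasurable.nullMeasurable
    (MeasurableSet.of_discrete (s := {σ | g σ ≤ w}))
  have h := integral_comp_eq_matchMean hπ fun σ => if g σ ≤ w then 1 else 0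
  have h2 : (fun ω => if g (π ω) ≤ w then (1 : ℝ) else 0) =
      {ω | g (π ω) ≤ w}.indicator fun _ => 1 := by
    ext ω; simp [Set.indicator]
  rw [h2, integral_indicator₀ hm] at h
  simpa [weightedCdf, matchMean] using h

lemma aemeasurable_comp (hπ : HasLaw π (uniformOn (matchings n)) P)
    (g : Equiv.Perm (Fin n) → ℝ) : AEMeasurable (fun ω => g (π ω)) P :=
  (measurable_of_finite g).comp_aemeasurable hπ.aemeasurable

end Law

/-! ### The coupling bound applied to the standardized statistic. -/

section Bound

variable {n : ℕ} {d : Fin n → Fin n → ℝ}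

namespace IsCenteredArray

/-- The Stein coupling bound for a standardized matching statistic, before simplification. -/
lemma weightedCdf_sub_le (hd : IsCenteredArray d) (hne : (matchings n).Nonempty) (hn : 10 ≤ n)
    (hS : 0 < ∑ i, ∑ j, d i j ^ 2) {s : ℝ} (hs : 0 < s)
    (hs2 : s ^ 2 = matchMean fun σ => matchingStat d σ ^ 2) (w : ℝ) :
    |weightedCdf (matchWeight n) (fun σ => matchingStat d σ / s) w
        - (gaussianReal 0 1).real (Set.Iic w)| ≤
      4 * (5 * √(n * ∑ i, ∑ j, d i j ^ 4) / ∑ i, ∑ j, d i j ^ 2)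
        + 20 * (16 * maxDiff d ^ 3 * n ^ 2 / (((n : ℝ) - 1) * s ^ 3)) + 4 * maxDiff d / s := by
  have hn' : (10 : ℝ) ≤ n := by exact_mod_cast hn
  have hn1 : (0 : ℝ) < (n : ℝ) - 1 := by linarith
  set S := ∑ i, ∑ j, d i j ^ 2 with hSdef
  set α := maxDiff d with hα
  -- The zero diagonal makes every entry a difference of entries, so `α` bounds entries too.
  have hdα : ∀ i j, |d i j| ≤ α := fun i j => by
    have := abs_sub_le_maxDiff d i j i i
    rwa [hd.diag, sub_zero] at this
  have hα0 : 0 < α := by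
    by_contra hneg
    have h0 : ∀ i j, d i j = 0 := fun i j => abs_nonpos_iff.1 ((hdα i j).trans (not_lt.1 hneg))
    simp [hSdef, h0] at hS
  have hmem : ∀ σ, matchWeight n σ ≠ 0 → σ ∈ matchings n := fun σ h =>
    by_contra fun h' => h (matchWeight_eq_zero h')
  have hΔ : ∀ σ ∈ matchings n, ∀ a k,
      |matchingStat d (swapConj a k σ) - matchingStat d σ| ≤ 4 * α := by
    intro σ hσ a k
    by_cases hk : k = σ a
    · rw [hk, swapConj_apply_partner hσ, sub_self, abs_zero]; linarith
    · rw [hd.matchingStat_swapConj_sub hσ hk]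
      have e1 := abs_le.1 (abs_sub_le_maxDiff d a (σ k) a (σ a))
      have e2 := abs_le.1 (abs_sub_le_maxDiff d k (σ a) k (σ k))
      rw [abs_le]
      constructor <;> linarith [e1.1, e1.2, e2.1, e2.2]
  refine stein_coupling_kolmogorov_bound (ι := Fin n × Fin n)
    (W' := fun i σ => matchingStat d (swapConj i.1 i.2 σ) / s)
    (G := fun i σ => d i.1 (σ i.2) / (((n : ℝ) - 1) * s))
    matchWeight_nonneg (sum_matchWeight hne) ?_ ?_ ?_ ?_ ?_ (by positivity) (by positivity) w
  · intro f
    have h := hd.stein_identity fun x => f (x / s)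
    have h1 : ∑ σ, matchWeight n σ * (matchingStat d σ / s * f (matchingStat d σ / s)) =
        s⁻¹ * matchMean fun σ => matchingStat d σ * f (matchingStat d σ / s) := by
      rw [← matchMean_const_mul]
      exact Finset.sum_congr rfl fun σ _ => by ring
    have h2 : ∑ σ, matchWeight n σ * ∑ i : Fin n × Fin n, d i.1 (σ i.2) / (((n : ℝ) - 1) * s) *
          (f (matchingStat d (swapConj i.1 i.2 σ) / s) - f (matchingStat d σ / s)) =
        (((n : ℝ) - 1) * s)⁻¹ * matchMean fun σ => ∑ a, ∑ k, d a (σ k) *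
          (f (matchingStat d (swapConj a k σ) / s) - f (matchingStat d σ / s)) := by
      rw [← matchMean_const_mul]
      refine Finset.sum_congr rfl fun σ _ => ?_
      rw [Fintype.sum_prod_type]
      simp only [Finset.mul_sum]
      exact Finset.sum_congr rfl fun a _ => Finset.sum_congr rfl fun k _ => by ring
    rw [h1, h2, ← h]
    field_simp
  · have h1 : ∑ σ, matchWeight n σ * (matchingStat d σ / s) ^ 2 =
        (s ^ 2)⁻¹ * matchMean fun σ => matchingStat d σ ^ 2 := by
      rw [← matchMean_const_mul]
      exact Finset.sum_congr rfl fun σ _ => by ring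
    rw [h1, ← hs2, inv_mul_cancel₀ (by positivity)]
  · intro i σ hσ
    rw [← sub_div, abs_div, abs_of_pos hs]
    gcongr
    exact hΔ σ (hmem σ hσ) _ _
  · intro σ hσ
    calc _ ≤ ∑ _i : Fin n × Fin n, α / (((n : ℝ) - 1) * s) * (4 * α / s) ^ 2 := by
          refine Finset.sum_le_sum fun i _ => ?_
          rw [abs_div, abs_of_pos (by positivity : 0 < ((n : ℝ) - 1) * s), ← sub_div,
            ← sq_abs, abs_div, abs_of_pos hs]
          gcongr
          · exact hdα _ _
          · exact hΔ σ (hmem σ hσ) _ _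
      _ = _ := by
          simp only [Finset.sum_const, Finset.card_univ, Fintype.card_prod, Fintype.card_fin,
            nsmul_eq_mul]
          push_cast
          field_simp
          ring
  · have hvar := hd.matchMean_matchingStat_sq hne (by omega)
    rw [← hs2, ← hSdef] at hvar
    have hn2 : (n : ℝ) - 2 ≠ 0 := by linarith
    have hn3 : (n : ℝ) - 3 ≠ 0 := by linarith
    have hcross := hd.matchMean_crossStat hne (by omega)
    rw [← hSdef] at hcross
    set B := crossStat d with hB
    set m := matchMean B with hm
    have h1 : ∑ σ, matchWeight n σ * |1 - ∑ i : Fin n × Fin n,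
          d i.1 (σ i.2) / (((n : ℝ) - 1) * s) *
            (matchingStat d (swapConj i.1 i.2 σ) / s - matchingStat d σ / s)| =
        matchMean fun σ => ((n : ℝ) - 3) / (((n : ℝ) - 2) * S) * |B σ - m| := by
      -- By the variance formula the weighted jumps sum to `(n-3)(S + B) / ((n-2) S)`. Its mean is
      -- one since `E B = S/(n-3)`, so the defect is a multiple of `B - E B`.
      refine matchMean_congr fun σ hσ => ?_
      have hpos : 0 ≤ ((n : ℝ) - 3) / (((n : ℝ) - 2) * S) :=
        div_nonneg (by linarith) (mul_nonneg (by linarith) hS.le)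
      have h2 : ∑ i : Fin n × Fin n, d i.1 (σ i.2) / (((n : ℝ) - 1) * s) *
            (matchingStat d (swapConj i.1 i.2 σ) / s - matchingStat d σ / s) =
          (2 * (S + B σ)) / (((n : ℝ) - 1) * s ^ 2) := by
        rw [hSdef, hB, ← hd.sum_mul_matchingStat_sub hσ, Fintype.sum_prod_type]
        simp only [Finset.sum_div]
        exact Finset.sum_congr rfl fun a _ => Finset.sum_congr rfl fun k _ => by
          field_simp
      rw [h2, ← abs_of_nonneg hpos, ← abs_mul, ← abs_neg]
      congr 1
      have hm' : m = S / ((n : ℝ) - 3) := by rw [eq_div_iff hn3]; linarith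
      have hn10 : (n : ℝ) - 1 ≠ 0 := hn1.ne'
      rw [hvar, hm']
      field_simp
      ring
    rw [h1, matchMean_const_mul]
    have h3 := sq_matchMean_abs_le hne fun σ => B σ - m
    have h4 : (matchMean fun σ => (B σ - m) ^ 2) = (matchMean fun σ => B σ ^ 2) - m ^ 2 := by
      have : (fun σ => (B σ - m) ^ 2) = fun σ => (B σ ^ 2 - (2 * m) * B σ) + m ^ 2 := by
        ext σ; ring
      rw [this, matchMean_add, matchMean_sub, matchMean_const_mul, matchMean_const hne, ← hm]
      ring
    have h5 := hd.matchMean_crossStat_sq_le hne hn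
    set X := (n : ℝ) * ∑ i, ∑ j, d i j ^ 4 with hX
    have hX0 : 0 ≤ X := mul_nonneg (by linarith)
      (Finset.sum_nonneg fun _ _ => Finset.sum_nonneg fun _ _ => by positivity)
    -- Cauchy–Schwarz and `Var B ≤ E B² ≤ 24 X ≤ (5√X)²`.
    have h6 : (matchMean fun σ => |B σ - m|) ≤ 5 * √X := by
      refine abs_le_of_sq_le_sq' ?_ (by positivity) |>.2
      rw [mul_pow, Real.sq_sqrt hX0]
      change (matchMean fun σ => B σ ^ 2) ≤ _ at h5
      nlinarith [sq_nonneg m]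
    have h7 : ((n : ℝ) - 3) / (((n : ℝ) - 2) * S) ≤ 1 / S := by
      rw [div_le_div_iff₀ (mul_pos (by linarith) hS) hS]
      nlinarith
    have h8 : 0 ≤ matchMean fun σ => |B σ - m| :=
      Finset.sum_nonneg fun σ _ => mul_nonneg (matchWeight_nonneg σ) (abs_nonneg _)
    calc _ ≤ 1 / S * (5 * √X) := mul_le_mul h7 h6 h8 (by positivity)
      _ = _ := by ring

/-- Everything is measured against `r = √(S/n)`: the target quantity is `α³ n / r³`, and `s` is at
least `√2 r`. The coefficients obtained are `20`, and `130 + 3` for the cubic and jump terms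
together. -/
lemma kolmogorov_bound (hd : IsCenteredArray d) (hne : (matchings n).Nonempty) (hn : 10 ≤ n)
    {s : ℝ} (hs : 0 < s)
    (hs2 : s ^ 2 = matchMean fun σ => matchingStat d σ ^ 2) (w : ℝ) :
    |weightedCdf (matchWeight n) (fun σ => matchingStat d σ / s) w
        - (gaussianReal 0 1).real (Set.Iic w)| ≤
      86 * (n : ℝ) ^ (1 / 2 : ℝ) *
          √((∑ i, ∑ j, d i j ^ 4) / (∑ i, ∑ j, d i j ^ 2) ^ 2)
        + 243 * maxDiff d ^ 3 * (n : ℝ) ^ (5 / 2 : ℝ) / (∑ i, ∑ j, d i j ^ 2) ^ (3 / 2 : ℝ) := by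
  have hn' : (10 : ℝ) ≤ n := by exact_mod_cast hn
  have hn0 : (0 : ℝ) < n := by linarith
  have hn1 : (0 : ℝ) < (n : ℝ) - 1 := by linarith
  have hvar := hd.matchMean_matchingStat_sq hne (by omega)
  rw [← hs2] at hvar
  have hS0 : 0 ≤ ∑ i, ∑ j, d i j ^ 2 :=
    Finset.sum_nonneg fun _ _ => Finset.sum_nonneg fun _ _ => sq_nonneg _
  have hS : 0 < ∑ i, ∑ j, d i j ^ 2 := by
    refine lt_of_le_of_ne hS0 fun h => ?_
    rw [← h, mul_zero] at hvar
    exact hs.ne' (pow_eq_zero_iff two_ne_zero |>.1 hvar)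
  refine (hd.weightedCdf_sub_le hne hn hS hs hs2 w).trans ?_
  set α := maxDiff d with hα
  have hdα : ∀ i j, |d i j| ≤ α := fun i j => by
    have := abs_sub_le_maxDiff d i j i i
    rwa [hd.diag, sub_zero] at this
  have hα0 : 0 ≤ α := (abs_nonneg _).trans (hdα ⟨0, by omega⟩ ⟨0, by omega⟩)
  have hSα : ∑ i, ∑ j, d i j ^ 2 ≤ n ^ 2 * α ^ 2 := by
    calc _ ≤ ∑ _i : Fin n, ∑ _j : Fin n, α ^ 2 :=
          Finset.sum_le_sum fun i _ => Finset.sum_le_sum fun j _ => by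
            rw [← sq_abs]; exact pow_le_pow_left₀ (abs_nonneg _) (hdα i j) 2
      _ = _ := by simp; ring
  set S := ∑ i, ∑ j, d i j ^ 2
  have hfirst : 4 * (5 * √(n * ∑ i, ∑ j, d i j ^ 4) / S) ≤
      86 * (n : ℝ) ^ (1 / 2 : ℝ) * √((∑ i, ∑ j, d i j ^ 4) / S ^ 2) := by
    rw [← Real.sqrt_eq_rpow, Real.sqrt_div' _ (sq_nonneg S), Real.sqrt_sq hS.le,
      Real.sqrt_mul hn0.le]
    have : 0 ≤ √(n : ℝ) * √(∑ i, ∑ j, d i j ^ 4) / S := by positivity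
    calc _ = 20 * (√(n : ℝ) * √(∑ i, ∑ j, d i j ^ 4) / S) := by ring
      _ ≤ 86 * (√(n : ℝ) * √(∑ i, ∑ j, d i j ^ 4) / S) := by linarith
      _ = _ := by ring
  set q := S / n with hq
  have hq0 : 0 < q := by positivity
  set r := √q with hr
  have hr0 : 0 < r := Real.sqrt_pos.2 hq0
  have hr2 : r ^ 2 = q := Real.sq_sqrt hq0.le
  have hSq : S = q * n := by rw [hq]; field_simp
  have hpow : (n : ℝ) ^ (5 / 2 : ℝ) / S ^ (3 / 2 : ℝ) = n / r ^ 3 := by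
    have e1 : (n : ℝ) ^ (5 / 2 : ℝ) = n * (n : ℝ) ^ (3 / 2 : ℝ) := by
      rw [show (5 / 2 : ℝ) = 1 + 3 / 2 by norm_num, Real.rpow_add hn0, Real.rpow_one]
    have e2 : q ^ (3 / 2 : ℝ) = r ^ 3 := by
      rw [hr, Real.sqrt_eq_rpow, ← Real.rpow_natCast, ← Real.rpow_mul hq0.le]
      norm_num
    have e3 : (n : ℝ) ^ (3 / 2 : ℝ) ≠ 0 := (Real.rpow_pos_of_pos hn0 _).ne'
    rw [hSq, Real.mul_rpow hq0.le hn0.le, e1, e2]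
    field_simp
  have hsr2 : 2 * r ^ 2 ≤ s ^ 2 := by
    rw [hr2, hvar, hq, div_mul_eq_mul_div, mul_div_assoc', div_le_div_iff₀ hn0
      (mul_pos hn1 (by linarith))]
    nlinarith
  have hsr : 1.4 * r ≤ s := by
    refine abs_le_of_sq_le_sq' ?_ hs.le |>.2
    nlinarith
  have hrα : r ^ 2 ≤ n * α ^ 2 := by
    rw [hr2, hq, div_le_iff₀ hn0]; linarith
  -- From `n - 1 ≥ 0.9 n` and `1.4³ = 2.744`, the constant is `320 / (0.9 · 2.744) < 130`.
  have hsecond : 20 * (16 * α ^ 3 * n ^ 2 / (((n : ℝ) - 1) * s ^ 3)) ≤ 130 * (α ^ 3 * (n / r ^ 3)) := by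
    have e1 : (1.4 * r) ^ 3 ≤ s ^ 3 := pow_le_pow_left₀ (by positivity) hsr 3
    have e2 : 320 * (n : ℝ) ^ 2 * r ^ 3 ≤ 130 * n * (((n : ℝ) - 1) * s ^ 3) := by
      have e3 : 0.9 * (n : ℝ) * (2.744 * r ^ 3) ≤ ((n : ℝ) - 1) * s ^ 3 := by
        refine mul_le_mul (by linarith) (le_trans (le_of_eq (by ring)) e1) (by positivity) hn1.le
      have e4 := mul_le_mul_of_nonneg_left e3 (by positivity : (0 : ℝ) ≤ 130 * n)
      have e5 : 0 ≤ (n : ℝ) ^ 2 * r ^ 3 := by positivity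
      nlinarith
    have e6 : 320 * (n : ℝ) ^ 2 / (((n : ℝ) - 1) * s ^ 3) ≤ 130 * n / r ^ 3 := by
      rw [div_le_div_iff₀ (by positivity) (by positivity)]; exact e2
    have e7 := mul_le_mul_of_nonneg_left e6 (by positivity : 0 ≤ α ^ 3)
    calc _ = α ^ 3 * (320 * (n : ℝ) ^ 2 / (((n : ℝ) - 1) * s ^ 3)) := by ring
      _ ≤ _ := e7
      _ = _ := by ring
  -- The jump term is absorbed into the cubic one: `r² ≤ n α²` gives `α / r ≤ n α³ / r³`.
  have hthird : 4 * α / s ≤ 3 * (α ^ 3 * (n / r ^ 3)) := by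
    calc _ ≤ 4 * α / (1.4 * r) := by gcongr
      _ ≤ 3 * (α / r) := by
          rw [mul_div_mul_comm]
          exact mul_le_mul_of_nonneg_right (by norm_num) (by positivity)
      _ = 3 * (α / r ^ 3 * r ^ 2) := by field_simp
      _ ≤ 3 * (α / r ^ 3 * (n * α ^ 2)) := by gcongr
      _ = _ := by ring
  have hlast : 243 * α ^ 3 * (n : ℝ) ^ (5 / 2 : ℝ) / S ^ (3 / 2 : ℝ) =
      243 * (α ^ 3 * (n / r ^ 3)) := by rw [← hpow]; ring
  have hX0 : 0 ≤ α ^ 3 * (n / r ^ 3) := by positivity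
  rw [hlast]
  linarith

end IsCenteredArray

end Bound
end MatchingTest

end

/-! ### Mean, variance and normal approximation for the original statistic. -/

theorem theorem1 {n : ℕ} (hn : 10 ≤ n) (hn_even : Even n)
    (e : Fin n → Fin n → ℝ) (he_symm : ∀ i j, e i j = e j i) (he_diag : ∀ i, e i i = 0)
    {Ω : Type*} [MeasurableSpace Ω] (P : Measure Ω) [IsProbabilityMeasure P]
    (π : Ω → Equiv.Perm (Fin n))
    (hπ : HasLaw π (uniformOn (MatchingTest.matchings n)) P)
    (U : Ω → ℝ) (hU : ∀ ω, U ω = MatchingTest.matchingStat e (π ω))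
    (d : Fin n → Fin n → ℝ) (hd : d = MatchingTest.centered e) :
    (∫ ω, U ω ∂P) = MatchingTest.totalSum e / ((n : ℝ) - 1) ∧
    variance U P =
      2 / (((n : ℝ) - 1) * ((n : ℝ) - 3)) *
        (((n : ℝ) - 2) * (∑ i, ∑ k, e i k ^ 2)
          + 1 / ((n : ℝ) - 1) * MatchingTest.totalSum e ^ 2
          - 2 * ∑ i, MatchingTest.rowSum e i ^ 2) ∧
    (0 < variance U P →
      MatchingTest.kolmogorovDistNormal (MatchingTest.standardize U P) P ≤
        86 * (n : ℝ) ^ (1 / 2 : ℝ) *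
            √((∑ i, ∑ j, d i j ^ 4) / (∑ i, ∑ j, d i j ^ 2) ^ 2)
          + 243 * MatchingTest.maxDiff d ^ 3 * (n : ℝ) ^ (5 / 2 : ℝ) /
            (∑ i, ∑ j, d i j ^ 2) ^ (3 / 2 : ℝ)) := by
  open MatchingTest in
  have hn' : (10 : ℝ) ≤ n := by exact_mod_cast hn
  have hn1 : (n : ℝ) - 1 ≠ 0 := by linarith
  have hne := nonempty_matchings_of_hasLaw hπ
  have hca : IsCenteredArray d := hd ▸ isCenteredArray_centered (by omega) he_symm he_diag
  have hUeq : U = fun ω => matchingStat e (π ω) := funext hU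
  have hmean : ∫ ω, U ω ∂P = totalSum e / ((n : ℝ) - 1) := by
    rw [hUeq, integral_comp_eq_matchMean hπ, eq_div_iff hn1, mul_comm]
    have h := matchMean_linear hne e
    simp only [he_diag, Finset.sum_const_zero, sub_zero] at h
    exact h
  -- The identity holds only on matchings, where no diagonal entry is sampled; this suffices because
  -- all other permutations have weight zero.
  have hcent : ∀ σ ∈ matchings n, matchingStat e σ - totalSum e / ((n : ℝ) - 1) =
      matchingStat d σ := fun σ hσ => by
    rw [hd, matchingStat_centered (by omega) he_symm hσ]
  have hvar : variance U P = matchMean fun σ => matchingStat d σ ^ 2 := by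
    have hmeas : AEMeasurable U P := hUeq ▸ aemeasurable_comp hπ (matchingStat e)
    rw [variance_eq_integral hmeas, hmean]
    simp only [hU]
    rw [integral_comp_eq_matchMean hπ fun σ => (matchingStat e σ - totalSum e / ((n : ℝ) - 1)) ^ 2]
    exact matchMean_congr fun σ hσ => by rw [hcent σ hσ]
  refine ⟨hmean, ?_, fun hpos => ?_⟩
  · rw [hvar, hca.matchMean_matchingStat_sq hne (by omega), hd,
      ← sum_sq_centered (by omega) he_symm he_diag]
    ring
  · refine ciSup_le fun w => ?_
    have hs := Real.sqrt_pos.2 hpos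
    have hs2 : √(variance U P) ^ 2 = matchMean fun σ => matchingStat d σ ^ 2 := by
      rw [Real.sq_sqrt hpos.le, hvar]
    refine le_trans (le_of_eq ?_) (hca.kolmogorov_bound hne hn hs hs2 w)
    have h1 : {ω | standardize U P ω ≤ w} = {ω | (fun σ => (matchingStat e σ -
        totalSum e / ((n : ℝ) - 1)) / √(variance U P)) (π ω) ≤ w} := by
      simp only [standardize, hmean]
      simp only [hU]
    simp only [h1]
    rw [measureReal_comp_le_eq_weightedCdf hπ fun σ => (matchingStat e σ -
        totalSum e / ((n : ℝ) - 1)) / √(variance U P)]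
    congr 2
    refine matchMean_congr (f := fun σ => if (matchingStat e σ -
        totalSum e / ((n : ℝ) - 1)) / √(variance U P) ≤ w then 1 else 0)
      (g := fun σ => if matchingStat d σ / √(variance U P) ≤ w then 1 else 0) fun σ hσ => ?_
    rw [hcent σ hσ]
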